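/- A ribbon graph $\mathbb{G}=(V,E)$ is a compact surface with boundary that is the union of finitely many discs, called vertices ($V$) and edges ($E$), such that vertices and edges meet in disjoint line segments, each segment lies on the boundary of exactly one vertex and one edge, and each edge contains exactly two segments. A coloured ribbon graph is a ribbon graph with a partition $\mathcal{V}$ of its vertices and a partition $\mathcal{B}$ of its boundary components into colour classes; coloured ribbon graphs are considered up to homeomorphism respecting vertices, edges and colour classes. Deleting an edge $e$ removes its disc, leaves the vertices and their colours unchanged, and merges the colour classes of the boundary components touching $e$ (each boundary component created lies in the merged class). Contracting $e$ glues a new vertex disc into each boundary curve of the union of $e$ with its end vertices and then removes $e$ and these vertices; it leaves the boundary components and their colours unchanged and merges the vertex colour classes of the ends of $e$ (each new vertex lies in the merged class). For $A\subseteq E$ let $A^c=E\setminus A$, and for an edge $e$ let $e^c=E\setminus\{e\}$. There are five connected coloured ribbon graphs with one edge: $\mathrm{bs}$ (two vertices of different colours joined by an edge), $\mathrm{bp}$ (the same with vertices of equal colour), $\mathrm{olc}$ (an annulus formed by one vertex and a loop, with boundary components of different colours), $\mathrm{olh}$ (the same with boundary components of equal colour) and $\mathrm{nl}$ (a Möbius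 band formed by one vertex and a loop). The edge $e$ has type $(i,j)$ if $(\mathbb{G}/e^c,\mathbb{G}\backslash e^c)=(i,j)$ after disregarding isolated vertices. Let $\alpha,\beta,\gamma,a_i,b_i$ ($i\in\{\mathrm{bs},\mathrm{bp},\mathrm{olc},\mathrm{olh}\}$) be indeterminates, with formal square roots as needed, and put $a_{\mathrm{nl}}=a_{\mathrm{bp}}^{1/2}a_{\mathrm{olh}}^{1/2}$ and $b_{\mathrm{nl}}=b_{\mathrm{bp}}^{1/2}b_{\mathrm{olh}}^{1/2}$. There is exactly one function $U$ from coloured ribbon graphs to $$\mathbb{Z}[\alpha,\beta,\gamma,a_{\mathrm{bs}},a_{\mathrm{bp}}^{1/2},a_{\mathrm{olc}},a_{\mathrm{olh}}^{1/2},b_{\mathrm{bs}},b_{\mathrm{bp}}^{1/2},b_{\mathrm{olc}},b_{\mathrm{olh}}^{1/2}]$$ such that $$U(\mathbb{G})=\begin{cases}a_iU(\mathbb{G}\backslash e)+b_jU(\mathbb{G}/e)&\text{for every edge } e \text{ of } \mathbb{G}\text{, where } (i,j) \text{ is its type};\\ \alpha^n\beta^m\gamma^v&\text{if }\mathbb{G}\text{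 is edgeless, with } v\text{ vertices, } n \text{ vertex and } m \text{ boundary colour classes.}\end{cases}$$ Let $\mathbb{G}/\mathcal{V}$ be the graph whose vertices are the vertex colour classes, in which each $e\in E$ joins the classes of its end vertices, and let $\mathbb{G}^*/\mathcal{B}$ be the graph whose vertices are the boundary colour classes, in which each $e\in E$ joins the classes of the boundary components touching its two sides. For a graph, let $k$ be the number of components and $r(A)$ the number of vertices minus the number of components of the spanning subgraph with edge set $A$. Let $v(\mathbb{G})=|V|$, let $b(A)$ be the number of boundary components of $\mathbb{G}\backslash A^c$, and put $\rho(A)=\tfrac12(|A|+|V|-b(A))$. Then for every coloured ribbon graph $$\begin{aligned}U(\mathbb{G})={}&\alpha^{k(\mathbb{G}/\mathcal{V})}\beta^{k(\mathbb{G}^*/\mathcal{B})}\gamma^{v(\mathbb{G})}(\alpha a_{\mathrm{bs}})^{r_1(E)}a_{\mathrm{bp}}^{r_2(E)}a_{\mathrm{olc}}^{r_3(E)}a_{\mathrm{olh}}^{r_4(E)}\\&\cdot\sum_{A\subseteq E}\Big(\frac{b_{\mathrm{bs}}}{\alpha\gamma a_{\mathrm{bs}}}\Big)^{r_1(A)}\Big(\frac{b_{\mathrm{bp}}}{\gamma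 a_{\mathrm{bp}}}\Big)^{r_2(A)}\Big(\frac{\beta\gamma b_{\mathrm{olc}}}{a_{\mathrm{olc}}}\Big)^{r_3(A)}\Big(\frac{\gamma b_{\mathrm{olh}}}{a_{\mathrm{olh}}}\Big)^{r_4(A)},\end{aligned}$$ where $$\begin{aligned}r_1(A)&=r_{\mathbb{G}/\mathcal{V}}(A),& r_2(A)&=\rho(A)-r_{\mathbb{G}/\mathcal{V}}(A),\\ r_3(A)&=r_{\mathbb{G}^*/\mathcal{B}}(E)-r_{\mathbb{G}^*/\mathcal{B}}(A^c),& r_4(A)&=|A|+r_{\mathbb{G}^*/\mathcal{B}}(A^c)-r_{\mathbb{G}^*/\mathcal{B}}(E)-\rho(A).\end{aligned}$$ -/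

import Mathlib

universe u

noncomputable section

/-! ### Ribbon graphs

A ribbon graph is a surface with boundary, cut into vertex discs and edge discs. It is encoded by
the following finite cell structure. The boundary circle of every vertex disc is subdivided, by a
finite non-empty set of points, into closed arcs that are alternately *corners* and *slots*. An edge
disc is attached to the vertex discs along exactly two slots, and every slot receives at most one
edge disc end; slots that receive none are allowed (so that, for example, an isolated vertex is
a circle made of one corner and one empty slot). `X` is the set of all subdivision points. Every
point `x` is an end of one corner, one slot, and, if its slot carries an edge disc, of one of
the two free sides of that edge disc. -/

/-- A ribbon graph with set of subdivision points `X`.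
* `c x` is the other end of the corner at `x`;
* `v x` is the other end of the slot at `x`;
* `f x` is the other end of the free side, starting at `x`, of the edge disc attached to the slot of
  `x`; if that slot is empty, then `f x = v x`.
The boundary of a vertex disc alternates between corners and slots. The boundary of the surface
alternates between corners and free sides or empty slots. -/
structure RibbonGraph (X : Type u) where
  finite : Finite X
  c : X → X
  v : X → X
  f : X → X
  c_c : ∀ x, c (c x) = x
  v_v : ∀ x, v (v x) = x
  f_f : ∀ x, f (f x) = x
  c_ne : ∀ x, c x ≠ x
  v_ne : ∀ x, v x ≠ x
  f_ne : ∀ x, f x ≠ x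
  v_f : ∀ x, v (f x) = f (v x)

namespace RibbonGraph

variable {X : Type u} (G : RibbonGraph X)

/-- The edges. An edge disc is identified with the set of its four corner points
`x`, `v x`, `f x`, `v (f x)`, where `x` is an end of a slot that is not empty. -/
def edges : Set (Set X) :=
  {e | ∃ x, v G x ≠ f G x ∧ e = {x, v G x, f G x, v G (f G x)}}

/-- The edges as a `Finset`. -/
def edgeFinset : Finset (Set X) :=
  haveI := G.finite
  (Set.toFinite G.edges).toFinset

/-- Lying on the boundary of the same vertex disc. The vertices are the classes. -/
def vertexRel : Setoid X :=
  Relation.EqvGen.setoid fun x y => y = G.c x ∨ y = G.v x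

/-- Lying on the same boundary component of the surface. The boundary components are the
classes. -/
def boundaryRel : Setoid X :=
  Relation.EqvGen.setoid fun x y => y = G.c x ∨ y = G.f x

/-- The number of vertices. -/
def numVertices : ℕ := Nat.card (Quotient G.vertexRel)

/-- The number of boundary components. -/
def numBoundary : ℕ := Nat.card (Quotient G.boundaryRel)

variable {G}

theorem edge_eq_of_mem {e : Set X} (he : e ∈ G.edges) {x : X} (hx : x ∈ e) :
    v G x ≠ f G x ∧ e = {x, v G x, f G x, v G (f G x)} := by
  obtain ⟨y, hy, rfl⟩ := he
  have h1 := G.v_v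
  have h2 := G.f_f
  have h3 := G.v_f
  rcases hx with rfl | rfl | rfl | rfl
  · exact ⟨hy, rfl⟩
  · refine ⟨?_, ?_⟩
    · intro h
      rw [h1, ← h3] at h
      exact hy (by rw [h, h1, ← h])
    · ext z
      simp only [Set.mem_insert_iff, Set.mem_singleton_iff, h1, ← h3]
      tauto
  · refine ⟨?_, ?_⟩
    · intro h
      rw [h2] at h
      exact hy (by rw [← h, h1, h])
    · ext z
      simp only [Set.mem_insert_iff, Set.mem_singleton_iff, h2]
      tauto
  · refine ⟨?_, ?_⟩
    · intro h
      rw [h1, h3, h2] at h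
      exact hy h.symm
    · ext z
      simp only [Set.mem_insert_iff, Set.mem_singleton_iff, h1, h3, h2]
      tauto

theorem v_mem {e : Set X} (he : e ∈ G.edges) {x : X} (hx : x ∈ e) : v G x ∈ e := by
  rw [(edge_eq_of_mem he hx).2]; simp

theorem f_mem {e : Set X} (he : e ∈ G.edges) {x : X} (hx : x ∈ e) : f G x ∈ e := by
  rw [(edge_eq_of_mem he hx).2]; simp

variable (G)

/-- The corner points of the edges of `G` that belong to `A`. -/
def pts (A : Set (Set X)) : Set X := ⋃₀ (A ∩ G.edges)

variable {G}

theorem v_mem_pts {A : Set (Set X)} {x : X} : v G x ∈ G.pts A ↔ x ∈ G.pts A := by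
  have key : ∀ y, y ∈ G.pts A → v G y ∈ G.pts A := fun y ⟨e, he, hy⟩ => ⟨e, he, v_mem he.2 hy⟩
  exact ⟨fun h => G.v_v x ▸ key _ h, key x⟩

theorem f_mem_pts {A : Set (Set X)} {x : X} : f G x ∈ G.pts A ↔ x ∈ G.pts A := by
  have key : ∀ y, y ∈ G.pts A → f G y ∈ G.pts A := fun y ⟨e, he, hy⟩ => ⟨e, he, f_mem he.2 hy⟩
  exact ⟨fun h => G.f_f x ▸ key _ h, key x⟩

variable (G)

open Classical in
/-- Deleting the edges of `G` in `A`: their edge discs are removed, so their slots become empty. -/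
def delete (A : Set (Set X)) : RibbonGraph X where
  finite := G.finite
  c := G.c
  v := G.v
  f x := if x ∈ G.pts A then G.v x else G.f x
  c_c := G.c_c
  v_v := G.v_v
  f_f x := by
    by_cases h : x ∈ G.pts A
    · simp [h, v_mem_pts, G.v_v]
    · simp [h, f_mem_pts, G.f_f]
  c_ne := G.c_ne
  v_ne := G.v_ne
  f_ne x := by
    split_ifs
    · exact G.v_ne x
    · exact G.f_ne x
  v_f x := by
    by_cases h : x ∈ G.pts A
    · simp [h, v_mem_pts]
    · simp [h, v_mem_pts, G.v_f]

open Classical in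
/-- Contracting the edges of `G` in `A`: the new vertex discs are glued into the boundary curves of
the union of these edge discs with the vertex discs, and the old discs are removed. So along
the boundary of a new vertex disc the free sides of these edge discs replace their slots. -/
def contract (A : Set (Set X)) : RibbonGraph X where
  finite := G.finite
  c := G.c
  v x := if x ∈ G.pts A then G.f x else G.v x
  f := G.f
  c_c := G.c_c
  v_v x := by
    by_cases h : x ∈ G.pts A
    · simp [h, f_mem_pts, G.f_f]
    · simp [h, v_mem_pts, G.v_v]
  f_f := G.f_f
  c_ne := G.c_ne
  v_ne x := by
    split_ifs
    · exact G.f_ne x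
    · exact G.v_ne x
  f_ne := G.f_ne
  v_f x := by
    by_cases h : x ∈ G.pts A
    · simp [h, f_mem_pts]
    · simp [h, f_mem_pts, G.v_f]

/-- The geometric dual: the boundary components are capped by new vertex discs, and the old
vertex discs are removed. The edge discs stay, with the roles of slots and free sides exchanged. -/
def dual : RibbonGraph X where
  finite := G.finite
  c := G.c
  v := G.f
  f := G.v
  c_c := G.c_c
  v_v := G.f_f
  f_f := G.v_v
  c_ne := G.c_ne
  v_ne := G.f_ne
  f_ne := G.v_ne
  v_f x := (G.v_f x).symm

/-- `ρ(A) = (|A| + |V| - b(A)) / 2`, where `b(A)` is the number of boundary components of the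
spanning ribbon subgraph with edge set `A`. -/
def rho (A : Finset (Set X)) : ℚ :=
  ((A.card : ℚ) + G.numVertices - (G.delete (G.edges \ (A : Set (Set X)))).numBoundary) / 2

end RibbonGraph

/-! ### Graphs -/

/-- The number of connected components of a graph. -/
def Graph.numComponents {α β : Type*} (G : Graph α β) : ℕ :=
  Nat.card (Quot fun x y : G.vertexSet => G.Adj x y)

/-- The rank `r(A)` of a set `A` of edges: the number of vertices minus the number of components of
the spanning subgraph with edge set `A`. -/
def Graph.rank {α β : Type*} (G : Graph α β) (A : Set β) : ℤ :=
  (Nat.card G.vertexSet : ℤ) - (G.restrict A).numComponents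

/-! ### Coloured ribbon graphs -/

/-- A coloured ribbon graph: a ribbon graph with a partition of its vertices and a partition of its
boundary components into colour classes. A partition of the vertices is given by the equivalence
relation on `X` of lying on vertices of the same colour, and likewise for boundary components. -/
structure ColouredRibbonGraph (X : Type u) extends RibbonGraph X where
  vcol : Setoid X
  bcol : Setoid X
  vertexRel_le : toRibbonGraph.vertexRel ≤ vcol
  boundaryRel_le : toRibbonGraph.boundaryRel ≤ bcol

namespace ColouredRibbonGraph

open RibbonGraph

variable {X : Type u} (G : ColouredRibbonGraph X)

/-- Deletion of the edges in `A`. Vertices and their colours are unchanged. For each deleted edge,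
the colour classes of the boundary components that touch its two sides are merged. -/
def delete (A : Set (Set X)) : ColouredRibbonGraph X where
  toRibbonGraph := G.toRibbonGraph.delete A
  vcol := G.vcol
  bcol := G.bcol ⊔ Relation.EqvGen.setoid fun x y => x ∈ G.pts A ∧ y = G.v x
  vertexRel_le := G.vertexRel_le
  boundaryRel_le := by
    refine Setoid.eqvGen_le ?_
    rintro x y (rfl | rfl)
    · exact (le_sup_left : G.bcol ≤ _)
        (G.boundaryRel_le (Relation.EqvGen.rel _ _ (Or.inl rfl)))
    · by_cases h : x ∈ G.pts A
      · have : (G.toRibbonGraph.delete A).f x = G.v x := if_pos h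
        rw [this]
        exact (le_sup_right : _ ≤ G.bcol ⊔ _) (Relation.EqvGen.rel _ _ ⟨h, rfl⟩)
      · have : (G.toRibbonGraph.delete A).f x = G.f x := if_neg h
        rw [this]
        exact (le_sup_left : G.bcol ≤ _)
          (G.boundaryRel_le (Relation.EqvGen.rel _ _ (Or.inr rfl)))

/-- Contraction of the edges in `A`. Boundary components and their colours are unchanged. For each
contracted edge, the colour classes of its end vertices are merged, and the new vertices belong to
the merged class. -/
def contract (A : Set (Set X)) : ColouredRibbonGraph X where
  toRibbonGraph := G.toRibbonGraph.contract A
  vcol := G.vcol ⊔ Relation.EqvGen.setoid fun x y => x ∈ G.pts A ∧ y = G.f x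
  bcol := G.bcol
  vertexRel_le := by
    refine Setoid.eqvGen_le ?_
    rintro x y (rfl | rfl)
    · exact (le_sup_left : G.vcol ≤ _)
        (G.vertexRel_le (Relation.EqvGen.rel _ _ (Or.inl rfl)))
    · by_cases h : x ∈ G.pts A
      · have : (G.toRibbonGraph.contract A).v x = G.f x := if_pos h
        rw [this]
        exact (le_sup_right : _ ≤ G.vcol ⊔ _) (Relation.EqvGen.rel _ _ ⟨h, rfl⟩)
      · have : (G.toRibbonGraph.contract A).v x = G.v x := if_neg h
        rw [this]
        exact (le_sup_left : G.vcol ≤ _)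
          (G.vertexRel_le (Relation.EqvGen.rel _ _ (Or.inr rfl)))
  boundaryRel_le := G.boundaryRel_le

/-- The dual, with the two colourings exchanged. -/
def dual : ColouredRibbonGraph X where
  toRibbonGraph := G.toRibbonGraph.dual
  vcol := G.bcol
  bcol := G.vcol
  vertexRel_le := G.boundaryRel_le
  boundaryRel_le := G.vertexRel_le

/-- The graph `𝔾/𝒱`. Its vertices are the vertex colour classes, and every edge of the ribbon graph
joins the colour classes of its two end vertices. (The two slots of an edge with corner point
`x` are those of `x` and of `f x`.) -/
def quotGraph : Graph (Quotient G.vcol) (Set X) where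
  vertexSet := Set.univ
  edgeSet := G.edges
  IsLink e p q := e ∈ G.edges ∧ ∃ x ∈ e, p = Quotient.mk G.vcol x ∧ q = Quotient.mk G.vcol (G.f x)
  isLink_symm e _ := ⟨by
    rintro p q ⟨he, x, hx, rfl, rfl⟩
    exact ⟨he, G.f x, f_mem he hx, rfl, by rw [G.f_f]⟩⟩
  eq_or_eq_of_isLink_of_isLink := by
    rintro e p q p' q' ⟨he, x, hx, rfl, rfl⟩ ⟨-, y, hy, rfl, rfl⟩
    have hv : ∀ z, Quotient.mk G.vcol (G.v z) = Quotient.mk G.vcol z := fun z =>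
      Quotient.sound (G.vcol.symm' (G.vertexRel_le (Relation.EqvGen.rel _ _ (Or.inr rfl))))
    rw [(edge_eq_of_mem he hy).2] at hx
    rcases hx with rfl | rfl | rfl | rfl
    · exact Or.inl rfl
    · exact Or.inl (hv _)
    · exact Or.inr rfl
    · exact Or.inr (hv _)
  edge_mem_iff_exists_isLink e := by
    refine ⟨fun he => ?_, fun ⟨_, _, h⟩ => h.1⟩
    obtain ⟨x, hx, h⟩ := id he
    exact ⟨_, _, he, x, by rw [h]; simp, rfl, rfl⟩
  left_mem_of_isLink _ _ _ _ := Set.mem_univ _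

/-- The graph `𝔾*/ℬ`. Its vertices are the boundary colour classes, and every edge of the ribbon
graph joins the colour classes of the boundary components that touch its two sides. -/
def dualQuotGraph : Graph (Quotient G.bcol) (Set X) := G.dual.quotGraph

/-- `k(𝔾/𝒱)`. -/
def kV : ℕ := G.quotGraph.numComponents

/-- `k(𝔾*/ℬ)`. -/
def kB : ℕ := G.dualQuotGraph.numComponents

/-- The exponent `r₁(A)`. -/
def r₁ (A : Finset (Set X)) : ℤ := G.quotGraph.rank A

/-- The exponent `r₂(A)`, a half-integer. -/
def r₂ (A : Finset (Set X)) : ℚ := G.rho A - G.quotGraph.rank A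

/-- The exponent `r₃(A)`. -/
def r₃ (A : Finset (Set X)) : ℤ :=
  G.dualQuotGraph.rank G.edges - G.dualQuotGraph.rank (G.edges \ (A : Set (Set X)))

/-- The exponent `r₄(A)`, a half-integer. -/
def r₄ (A : Finset (Set X)) : ℚ :=
  (A.card : ℚ) + G.dualQuotGraph.rank (G.edges \ (A : Set (Set X)))
    - G.dualQuotGraph.rank G.edges - G.rho A

theorem exists_two_mul_r₂ (A : Finset (Set X)) : ∃ n : ℤ, 2 * G.r₂ A = n :=
  ⟨A.card + G.numVertices
      - (G.toRibbonGraph.delete (G.edges \ (A : Set (Set X)))).numBoundary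
      - 2 * G.quotGraph.rank A, by
    simp only [r₂, rho]; push_cast; ring⟩

theorem exists_two_mul_r₄ (A : Finset (Set X)) : ∃ n : ℤ, 2 * G.r₄ A = n :=
  ⟨2 * (A.card + G.dualQuotGraph.rank (G.edges \ (A : Set (Set X)))
        - G.dualQuotGraph.rank G.edges)
      - (A.card + G.numVertices
        - (G.toRibbonGraph.delete (G.edges \ (A : Set (Set X)))).numBoundary), by
    simp only [r₄, rho]; push_cast; ring⟩

end ColouredRibbonGraph

/-! ### Edge types -/

/-- The five connected coloured ribbon graphs with exactly one edge. -/
inductive EdgeKind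
  | bs | bp | olc | olh | nl

/-- `H.IsKind e k` says that the coloured ribbon graph `H`, whose only edge is `e`, is the one-edge
coloured ribbon graph `k` once isolated vertices are disregarded. Let `x` be a corner point of `e`.
The end vertices of `e` are those of `x` and `f x`, and the boundary components that touch `e`
are those of `x` and `v x`.
* `bs`: `e` joins two vertices of different colours;
* `bp`: `e` joins two vertices of the same colour;
* `olc`: `e` is a loop that forms an annulus with its vertex (so it has two boundary components),
  and the two boundary components have different colours;
* `olh`: the same, but the two boundary components have the same colour;
* `nl`: `e` is a loop that forms a Möbius band with its vertex (so it has one boundary component). -/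
def ColouredRibbonGraph.IsKind {X : Type u} (H : ColouredRibbonGraph X) (e : Set X) :
    EdgeKind → Prop
  | .bs => ∃ x ∈ e, ¬ H.vertexRel x (H.f x) ∧ ¬ H.vcol x (H.f x)
  | .bp => ∃ x ∈ e, ¬ H.vertexRel x (H.f x) ∧ H.vcol x (H.f x)
  | .olc => ∃ x ∈ e, H.vertexRel x (H.f x) ∧ ¬ H.boundaryRel x (H.v x) ∧ ¬ H.bcol x (H.v x)
  | .olh => ∃ x ∈ e, H.vertexRel x (H.f x) ∧ ¬ H.boundaryRel x (H.v x) ∧ H.bcol x (H.v x)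
  | .nl => ∃ x ∈ e, H.vertexRel x (H.f x) ∧ H.boundaryRel x (H.v x)

/-- The edge `e` of `G` is of type `(i, j)` if `(G / eᶜ, G \ eᶜ)` is `(i, j)` after isolated
vertices are disregarded, where `eᶜ` is the set of edges other than `e`. -/
def ColouredRibbonGraph.IsType {X : Type u} (G : ColouredRibbonGraph X) (e : Set X)
    (i j : EdgeKind) : Prop :=
  (G.contract (G.edges \ {e})).IsKind e i ∧ (G.delete (G.edges \ {e})).IsKind e j

/-! ### Equivalence -/

/-- `φ : Y → X` exhibits `H` as the result of forgetting some empty slots of `G` (possibly none)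
together with their end points. No two forgotten slots are consecutive on a vertex (in
particular no vertex loses all its slots), and each forgotten slot is fused with the two corners
next to it into one corner. -/
structure ColouredRibbonGraph.IsErasure {X Y : Type u} (G : ColouredRibbonGraph X)
    (H : ColouredRibbonGraph Y) (φ : Y → X) : Prop where
  injective : Function.Injective φ
  map_v : ∀ y, G.v (φ y) = φ (H.v y)
  map_f : ∀ y, G.f (φ y) = φ (H.f y)
  map_c : ∀ y, G.c (φ y) = φ (H.c y) ∨
    (G.c (φ y) ∉ Set.range φ ∧ G.c (G.v (G.c (φ y))) = φ (H.c y))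
  unattached : ∀ x, x ∉ Set.range φ → G.f x = G.v x ∧ G.c x ∈ Set.range φ
  vcol_iff : ∀ y z, H.vcol y z ↔ G.vcol (φ y) (φ z)
  bcol_iff : ∀ y z, H.bcol y z ↔ G.bcol (φ y) (φ z)

/-- Equivalence of coloured ribbon graphs: being the same up to relabelling the subdivision points
and up to inserting and forgetting empty slots. -/
inductive ColouredRibbonGraph.Equivalent :
    ∀ {X Y : Type u}, ColouredRibbonGraph X → ColouredRibbonGraph Y → Prop
  | erase {X Y : Type u} (G : ColouredRibbonGraph X) (H : ColouredRibbonGraph Y) (φ : Y → X)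
      (h : G.IsErasure H φ) : Equivalent G H
  | symm {X Y : Type u} (G : ColouredRibbonGraph X) (H : ColouredRibbonGraph Y)
      (h : Equivalent G H) : Equivalent H G
  | trans {X Y Z : Type u} (G : ColouredRibbonGraph X) (H : ColouredRibbonGraph Y)
      (K : ColouredRibbonGraph Z) (h : Equivalent G H) (h' : Equivalent H K) : Equivalent G K

/-! ### Coefficients -/

/-- The names of the indeterminates `α, β, γ, a_bs, a_bp, a_olc, a_olh, b_bs, b_bp, b_olc, b_olh`. -/
inductive Param
  | α | β | γ | aBs | aBp | aOlc | aOlh | bBs | bBp | bOlc | bOlh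

/-- The field of rational functions over `ℚ` in formal square roots of all the indeterminates. -/
abbrev ParamField : Type := FractionRing (MvPolynomial Param ℤ)

/-- The formal square root of an indeterminate. -/
def sqrtVar (p : Param) : ParamField :=
  algebraMap (MvPolynomial Param ℤ) ParamField (MvPolynomial.X p)

/-- An indeterminate. -/
def var (p : Param) : ParamField := sqrtVar p ^ 2

/-- The polynomial ring `ℤ[α, β, γ, a_bs, a_bp^{1/2}, a_olc, a_olh^{1/2},
b_bs, b_bp^{1/2}, b_olc, b_olh^{1/2}]`. -/
def coeffRing : Subring ParamField :=
  Subring.closure {var .α, var .β, var .γ, var .aBs, sqrtVar .aBp, var .aOlc, sqrtVar .aOlh,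
    var .bBs, sqrtVar .bBp, var .bOlc, sqrtVar .bOlh}

/-- The power `z ^ q` for a half-integer `q`, where `s` is the chosen square root of `z`. -/
def halfPow (s : ParamField) (q : ℚ) : ParamField := s ^ ⌊2 * q⌋

/-- The coefficients `a_i`, where `a_nl = a_bp^{1/2} a_olh^{1/2}`. -/
def aCoeff : EdgeKind → ParamField
  | .bs => var .aBs
  | .bp => var .aBp
  | .olc => var .aOlc
  | .olh => var .aOlh
  | .nl => sqrtVar .aBp * sqrtVar .aOlh

/-- The coefficients `b_j`, where `b_nl = b_bp^{1/2} b_olh^{1/2}`. -/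
def bCoeff : EdgeKind → ParamField
  | .bs => var .bBs
  | .bp => var .bBp
  | .olc => var .bOlc
  | .olh => var .bOlh
  | .nl => sqrtVar .bBp * sqrtVar .bOlh

/-- `U` satisfies the deletion-contraction recursion:
`U(𝔾) = a_i U(𝔾 \ e) + b_j U(𝔾 / e)` for every edge `e`, where `(i, j)` is the type of `e`, and
`U(𝔾) = α ^ n β ^ m γ ^ v` if `𝔾` is edgeless with `v` vertices, `n` vertex colour classes and `m`
boundary colour classes. -/
structure IsDeletionContraction
    (U : ∀ X : Type u, ColouredRibbonGraph X → coeffRing) : Prop where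
  step : ∀ (X : Type u) (G : ColouredRibbonGraph X), ∀ e ∈ G.edges, ∀ i j, G.IsType e i j →
    (U X G : ParamField)
      = aCoeff i * U X (G.delete {e}) + bCoeff j * U X (G.contract {e})
  edgeless : ∀ (X : Type u) (G : ColouredRibbonGraph X), G.edges = ∅ →
    (U X G : ParamField)
      = var .α ^ Nat.card (Quotient G.vcol) * var .β ^ Nat.card (Quotient G.bcol)
          * var .γ ^ G.numVertices

end

/-! Contracting the edges in A and deleting the others gives an edgeless coloured ribbon graph, the
state of A (`state`). Unfolding the recursion along any order of the edges writes U as a sum over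
all A of the value of the state times a monomial in the a_i and b_j. This gives uniqueness, since
every edge has a type; for existence the monomial must not depend on the order.

It does not, because its exponents are increments of a function of A. The vector `exps A` = (r₁,
2r₂, r₃, 2r₄) is an integer combination of |A| and of the numbers of vertices, vertex colours and
boundary colours of the states of ∅ and A. A ribbon graph with one edge has two states, and
`exps_of_isKind` shows that the change in these numbers from one to the other is the exponent vector
of its kind. If e has type (i, j), then G / eᶜ has the states E \ e and E of G, and G \ eᶜ has the
states ∅ and {e}. So i is the increment of `exps` from E \ e to E and j the one from ∅ to {e};
telescoping gives `exps_edgeFinset`, `exps_insert` and then the recursion `stateSum_step`.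

The topological input is `numBoundary_of_edges_eq_singleton`, which rests on a count of fixed points
in a dihedral orbit (`exists_partner`). The closed formula follows by expressing ranks through
colour counts of states (`rank_quotGraph`, `rank_dualQuotGraph`) and comparing exponents.
Equivalence invariance holds because forgetting empty slots changes neither types nor the values of
edgeless graphs. -/

noncomputable section

/-! ### Joining two classes of an equivalence relation. -/

namespace Setoid

variable {X : Type u}

/-- The setoid generated by a single pair. -/
def pair (p q : X) : Setoid X := Relation.EqvGen.setoid fun x y => x = p ∧ y = q

theorem pair_le {p q : X} {s : Setoid X} : pair p q ≤ s ↔ s p q := by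
  constructor
  · intro h
    exact h (Relation.EqvGen.rel _ _ ⟨rfl, rfl⟩)
  · intro h
    refine Setoid.eqvGen_le ?_
    rintro x y ⟨rfl, rfl⟩
    exact h

theorem sup_pair_rel (s : Setoid X) (p q : X) : (s ⊔ pair p q) p q :=
  pair_le.1 le_sup_right

theorem sup_pair_of_rel {s : Setoid X} {p q : X} (h : s p q) : s ⊔ pair p q = s :=
  sup_eq_left.2 (pair_le.2 h)

/-- Redirecting the class of q to that of p gives a map whose kernel is the join and whose range
misses exactly one class. -/
theorem card_sup_pair [Finite X] {s : Setoid X} {p q : X} (h : ¬ s p q) :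
    Nat.card (Quotient (s ⊔ pair p q)) + 1 = Nat.card (Quotient s) := by
  classical
  let F : Quotient s → Quotient s := fun c => if c = Quotient.mk s q then Quotient.mk s p else c
  have hne : Quotient.mk s p ≠ Quotient.mk s q := fun e => h (Quotient.exact e)
  have hF : ∀ x, (s ⊔ pair p q) x (F (Quotient.mk s x)).out := by
    intro x
    by_cases hx : Quotient.mk s x = Quotient.mk s q
    · have h1 : F (Quotient.mk s x) = Quotient.mk s p := if_pos hx
      rw [h1]
      refine Setoid.trans' _ ((le_sup_left : s ≤ _) (Quotient.exact hx)) ?_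
      refine Setoid.trans' _ (Setoid.symm' _ (sup_pair_rel s p q)) ?_
      exact (le_sup_left : s ≤ _) (Setoid.symm' _ (Quotient.mk_out (s := s) p))
    · have h1 : F (Quotient.mk s x) = Quotient.mk s x := if_neg hx
      rw [h1]
      exact (le_sup_left : s ≤ _) (Setoid.symm' _ (Quotient.mk_out (s := s) x))
  have key : s ⊔ pair p q = Setoid.ker fun x => F (Quotient.mk s x) := by
    apply le_antisymm
    · refine sup_le ?_ (pair_le.2 ?_)
      · intro x y hxy
        rw [Setoid.ker_def, Quotient.sound (s := s) hxy]
      · simp [Setoid.ker_def, F]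
    · intro x y hxy
      rw [Setoid.ker_def] at hxy
      refine Setoid.trans' _ (hF x) ?_
      rw [hxy]
      exact Setoid.symm' _ (hF y)
  have hr : Set.range (fun x => F (Quotient.mk s x)) = {Quotient.mk s q}ᶜ := by
    ext c
    induction c using Quotient.inductionOn with
    | h z =>
      constructor
      · rintro ⟨x, hx⟩
        rw [Set.mem_compl_singleton_iff, ← hx]
        by_cases hx : Quotient.mk s x = Quotient.mk s q
        · simp [F, hx, hne]
        · simp [F, hx]
      · intro hz
        exact ⟨z, if_neg hz⟩
  rw [key, Nat.card_congr (Setoid.quotientKerEquivRange _), hr, Nat.card_coe_set_eq,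
    ← Set.ncard_add_ncard_compl {Quotient.mk s q}, Set.ncard_singleton, add_comm]

end Setoid

/-! ### Topology of ribbon graphs with one edge. -/

/-- Two involutions `c`, `w`, the first of them without fixed points, generate a dihedral group;
the orbit of a fixed point of `w` contains exactly one other fixed point of `w`. -/
theorem exists_partner {X : Type u} [Finite X] {c w : X → X} (hc : Function.Involutive c)
    (hw : Function.Involutive w) (hcne : ∀ x, c x ≠ x) {p : X} (hp : w p = p) :
    ∃ q, q ≠ p ∧ w q = q ∧ Relation.EqvGen.setoid (fun x y => y = c x ∨ y = w x) p q ∧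
      ∀ r, w r = r → Relation.EqvGen.setoid (fun x y => y = c x ∨ y = w x) p r →
        r = p ∨ r = q := by
  set R := Relation.EqvGen.setoid (fun x y => y = c x ∨ y = w x) with hR
  let C : Equiv.Perm X := hc.toPerm
  let W : Equiv.Perm X := hw.toPerm
  have hCC : C * C = 1 := by ext x; exact hc x
  have hWW : W * W = 1 := by ext x; exact hw x
  have hCi : C⁻¹ = C := inv_eq_of_mul_eq_one_left hCC
  have hWi : W⁻¹ = W := inv_eq_of_mul_eq_one_left hWW
  -- The orbit of p consists of the points σ^k p. As w fixes p, it acts on the exponents by k ↦ -k,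
  -- and c acts by k ↦ -k - 1.
  set σ : Equiv.Perm X := W * C with hσ
  have hWσ : ∀ k : ℤ, W * σ ^ k * W⁻¹ = σ ^ (-k) := by
    intro k
    rw [← conj_zpow, zpow_neg, ← inv_zpow]
    congr 1
    rw [hσ, mul_inv_rev, hCi, hWi, ← mul_assoc, hWW, one_mul]
  have hwk : ∀ k : ℤ, w ((σ ^ k) p) = (σ ^ (-k)) p := by
    intro k
    have := congrArg (fun g : Equiv.Perm X => g p) (hWσ k)
    rw [hWi] at this
    simpa [Equiv.Perm.mul_apply, W, hp] using this
  have hck : ∀ k : ℤ, c ((σ ^ k) p) = (σ ^ (-k - 1)) p := by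
    intro k
    have h1 : w (c ((σ ^ k) p)) = (σ ^ (k + 1)) p := by
      rw [add_comm, zpow_add, zpow_one]; rfl
    rw [← hw (c _), h1, hwk]
    congr 2
    ring
  have horb : ∀ x, R p x → ∃ k : ℤ, x = (σ ^ k) p := by
    intro x hx
    have step : ∀ a b, R a b → ((∃ k : ℤ, a = (σ ^ k) p) ↔ ∃ k : ℤ, b = (σ ^ k) p) := by
      intro a b hab
      induction hab with
      | rel a b h =>
        rcases h with rfl | rfl
        · constructor
          · rintro ⟨k, rfl⟩; exact ⟨_, hck k⟩
          · rintro ⟨k, hk⟩; exact ⟨_, by rw [← hc a, hk, hck]⟩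
        · constructor
          · rintro ⟨k, rfl⟩; exact ⟨_, hwk k⟩
          · rintro ⟨k, hk⟩; exact ⟨_, by rw [← hw a, hk, hwk]⟩
      | refl => rfl
      | symm _ _ _ ih => exact ih.symm
      | trans _ _ _ _ _ ih1 ih2 => exact ih1.trans ih2
    exact (step p x hx).1 ⟨0, by simp⟩
  have hrel : ∀ k : ℤ, R p ((σ ^ k) p) := by
    have hst : ∀ x, R x (σ x) := fun x =>
      Setoid.trans' _ (Relation.EqvGen.rel _ _ (Or.inl rfl) : R x (c x))
        (Relation.EqvGen.rel _ _ (Or.inr rfl))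
    intro k
    induction k using Int.induction_on with
    | zero => exact Setoid.refl' _ _
    | succ k ih =>
      have h := hst ((σ ^ (k : ℤ)) p)
      rw [add_comm, zpow_add, zpow_one]
      exact Setoid.trans' _ ih h
    | pred k ih =>
      have h := hst ((σ ^ (-(k : ℤ) - 1)) p)
      rw [← Equiv.Perm.mul_apply, ← zpow_one_add, add_sub_cancel] at h
      exact Setoid.trans' _ ih (Setoid.symm' _ h)
  have hper : ∀ k : ℤ, (σ ^ k) p = p ↔ (Function.minimalPeriod (σ • ·) p : ℤ) ∣ k := fun k =>
    MulAction.zpow_smul_eq_iff_minimalPeriod_dvd (a := σ) (b := p)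
  have heq : ∀ k l : ℤ, (σ ^ k) p = (σ ^ l) p ↔ (Function.minimalPeriod (σ • ·) p : ℤ) ∣ k - l := by
    intro k l
    rw [← hper, sub_eq_neg_add, zpow_add, Equiv.Perm.mul_apply, zpow_neg, Equiv.Perm.inv_eq_iff_eq]
  have hpos : 0 < Function.minimalPeriod (σ • ·) p :=
    Function.minimalPeriod_pos_of_mem_periodicPts
      (Function.Injective.mem_periodicPts (MulAction.injective σ) p)
  set n := Function.minimalPeriod (σ • ·) p
  -- For an odd period 2k + 1, the exponents k and -k - 1 would give the same point, which c would
  -- fix.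
  obtain ⟨m, hm⟩ : Even n := by
    rw [← Nat.not_odd_iff_even]
    rintro ⟨k, hk⟩
    refine hcne ((σ ^ (k : ℤ)) p) ?_
    rw [hck, heq]
    exact ⟨-1, by rw [hk]; push_cast; ring⟩
  have hm0 : 0 < m := by omega
  -- With n = 2m, the point σ^k p is fixed by w exactly if 2m divides 2k, so k is 0 or m modulo n.
  refine ⟨(σ ^ (m : ℤ)) p, ?_, ?_, hrel _, ?_⟩
  · rw [Ne, hper]
    intro h
    have := Int.le_of_dvd (by omega) h
    omega
  · rw [hwk, heq]
    exact ⟨-1, by rw [hm]; push_cast; ring⟩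
  · intro r hr hpr
    obtain ⟨k, rfl⟩ := horb r hpr
    rw [hwk, heq] at hr
    obtain ⟨j, hj⟩ := hr
    rw [hm] at hj
    push_cast at hj
    have hk : k = m * -j := by linarith
    rcases Int.even_or_odd' j with ⟨i, rfl | rfl⟩
    · left
      rw [hper]
      exact ⟨-i, by rw [hk, hm]; push_cast; ring⟩
    · right
      rw [heq]
      exact ⟨-i - 1, by rw [hk, hm]; push_cast; ring⟩

namespace Setoid

/-- Four points of a set with an equivalence relation that identifies them in pairs, joined in two
ways by two further identifications. -/
theorem card_quotient_switch {X : Type u} [Finite X] {R V B : Setoid X} {p a b d : X}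
    (hV : V = R ⊔ pair p a ⊔ pair b d) (hB : B = R ⊔ pair p b ⊔ pair a d)
    (h : (R p a ∧ R b d ∧ ¬ R p b) ∨ (R p b ∧ R a d ∧ ¬ R p a) ∨
      (R p d ∧ R a b ∧ ¬ R p a ∧ ¬ R p b)) :
    (¬ V p b ∧ B p a ∧ Nat.card (Quotient B) + 1 = Nat.card (Quotient V)) ∨
    (V p b ∧ ¬ B p a ∧ Nat.card (Quotient B) = Nat.card (Quotient V) + 1) ∨
    (V p b ∧ B p a ∧ Nat.card (Quotient B) = Nat.card (Quotient V)) := by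
  have hl : ∀ {x y u v}, R x y → (R ⊔ pair u v) x y := fun h => (le_sup_left : R ≤ _) h
  rcases h with ⟨h1, h2, h3⟩ | ⟨h1, h2, h3⟩ | ⟨h1, h2, h3, h4⟩
  -- Here R already contains both identifications that define V, while those that define B join the
  -- same two classes of R. The second case exchanges V and B; in the third, V and B both join the
  -- classes of p and a.
  · left
    rw [sup_pair_of_rel h1, sup_pair_of_rel h2] at hV
    have h5 : (R ⊔ pair p b) a d :=
      Setoid.trans' _ (Setoid.symm' _ (hl h1)) (Setoid.trans' _ (sup_pair_rel R p b) (hl h2))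
    rw [sup_pair_of_rel h5] at hB
    subst hV hB
    exact ⟨h3, hl h1, card_sup_pair h3⟩
  · right; left
    rw [sup_pair_of_rel h1, sup_pair_of_rel h2] at hB
    have h5 : (R ⊔ pair p a) b d :=
      Setoid.trans' _ (Setoid.symm' _ (hl h1)) (Setoid.trans' _ (sup_pair_rel R p a) (hl h2))
    rw [sup_pair_of_rel h5] at hV
    subst hV hB
    exact ⟨hl h1, h3, (card_sup_pair h3).symm⟩
  · right; right
    have h5 : (R ⊔ pair p b) a d :=
      Setoid.trans' _ (hl h2) (Setoid.trans' _ (Setoid.symm' _ (sup_pair_rel R p b)) (hl h1))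
    have h6 : (R ⊔ pair p a) b d :=
      Setoid.trans' _ (Setoid.symm' _ (hl h2))
        (Setoid.trans' _ (Setoid.symm' _ (sup_pair_rel R p a)) (hl h1))
    rw [sup_pair_of_rel h5] at hB
    rw [sup_pair_of_rel h6] at hV
    subst hV hB
    refine ⟨Setoid.trans' _ (sup_pair_rel R p a) (hl h2),
      Setoid.trans' _ (sup_pair_rel R p b) (Setoid.symm' _ (hl h2)), ?_⟩
    have := card_sup_pair h3
    have := card_sup_pair h4
    omega

end Setoid

namespace RibbonGraph

variable {X : Type u} {H : RibbonGraph X}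

theorem v_eq_f_of_forall_notMem {x : X} (hx : ∀ e ∈ H.edges, x ∉ e) : H.v x = H.f x := by
  by_contra h
  exact hx _ ⟨x, h, rfl⟩ (by simp)

/-- In a ribbon graph whose only edge has the corner point `x`, the numbers of vertices and boundary
components differ by at most one: there is one vertex more if the edge is not a loop, one
boundary component more if it is an orientable loop, and they are equal otherwise. -/
theorem numBoundary_of_edges_eq_singleton {e : Set X} (he : H.edges = {e}) {x : X} (hx : x ∈ e) :
    (¬ H.vertexRel x (H.f x) ∧ H.boundaryRel x (H.v x) ∧ H.numBoundary + 1 = H.numVertices) ∨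
    (H.vertexRel x (H.f x) ∧ ¬ H.boundaryRel x (H.v x) ∧ H.numBoundary = H.numVertices + 1) ∨
    (H.vertexRel x (H.f x) ∧ H.boundaryRel x (H.v x) ∧ H.numBoundary = H.numVertices) := by
  classical
  have := H.finite
  have heE : e ∈ H.edges := he ▸ rfl
  obtain ⟨hvf, hexp⟩ := edge_eq_of_mem heE hx
  have hoff : ∀ y, y ∉ e → H.v y = H.f y := by
    intro y hy
    refine v_eq_f_of_forall_notMem ?_
    rw [he]
    rintro _ rfl
    exact hy
  have hfe : ∀ {y}, y ∈ e ↔ y = x ∨ y = H.v x ∨ y = H.f x ∨ y = H.v (H.f x) := by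
    intro y
    rw [hexp]; simp
  -- Cutting the surface along e: off e the maps v and f agree with w, and the four corner points of
  -- e are the fixed points of w. The classes of R containing them are arcs. Vertices arise by
  -- joining their ends along the slots of e, boundary components by joining them along its free
  -- sides.
  let w : X → X := fun y => if y ∈ e then y else H.v y
  have hwin : ∀ {y}, y ∈ e → w y = y := fun h => if_pos h
  have hwout : ∀ {y}, y ∉ e → w y = H.v y := fun h => if_neg h
  have hmv : ∀ {y}, H.v y ∈ e ↔ y ∈ e := fun {y} =>
    ⟨fun h => H.v_v y ▸ v_mem heE h, v_mem heE⟩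
  have hww : Function.Involutive w := by
    intro y
    by_cases hy : y ∈ e
    · rw [hwin hy, hwin hy]
    · rw [hwout hy, hwout (mt hmv.1 hy), H.v_v]
  have hfix : ∀ {y}, w y = y ↔ y ∈ e := by
    intro y
    refine ⟨fun h => ?_, hwin⟩
    by_contra hy
    rw [hwout hy] at h
    exact H.v_ne _ h
  set R := Relation.EqvGen.setoid (fun a b => b = H.c a ∨ b = w a) with hR
  have h1 : x ≠ H.v x := (H.v_ne x).symm
  have h2 : x ≠ H.f x := (H.f_ne x).symm
  have h3 : x ≠ H.v (H.f x) := by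
    intro h
    apply hvf
    conv_lhs => rw [h]
    rw [H.v_v]
  have h4 : H.v x ≠ H.v (H.f x) := by
    intro h
    apply h2
    have := congrArg H.v h
    rwa [H.v_v, H.v_v] at this
  have h5 : H.f x ≠ H.v (H.f x) := (H.v_ne _).symm
  refine Setoid.card_quotient_switch (R := R) (d := H.v (H.f x)) ?_ ?_ ?_
  · apply le_antisymm
    · refine Setoid.eqvGen_le ?_
      rintro y z (rfl | rfl)
      · exact (le_sup_left.trans le_sup_left : R ≤ _) (Relation.EqvGen.rel _ _ (Or.inl rfl))
      · by_cases hy : y ∈ e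
        · have k1 : (R ⊔ Setoid.pair x (H.v x) ⊔ Setoid.pair (H.f x) (H.v (H.f x))) x (H.v x) :=
            (le_sup_left : _ ≤ _ ⊔ Setoid.pair (H.f x) (H.v (H.f x))) (Setoid.sup_pair_rel _ _ _)
          have k2 := Setoid.sup_pair_rel (R ⊔ Setoid.pair x (H.v x)) (H.f x) (H.v (H.f x))
          rcases hfe.1 hy with rfl | rfl | rfl | rfl
          · exact k1
          · rw [H.v_v]; exact Setoid.symm' _ k1
          · exact k2
          · rw [H.v_v]; exact Setoid.symm' _ k2
        · rw [← hwout hy]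
          exact (le_sup_left.trans le_sup_left : R ≤ _) (Relation.EqvGen.rel _ _ (Or.inr rfl))
    · refine sup_le (sup_le (Setoid.eqvGen_le ?_) (Setoid.pair_le.2 ?_)) (Setoid.pair_le.2 ?_)
      · rintro y z (rfl | rfl)
        · exact Relation.EqvGen.rel _ _ (Or.inl rfl)
        · by_cases hy : y ∈ e
          · rw [hwin hy]
          · rw [hwout hy]; exact Relation.EqvGen.rel _ _ (Or.inr rfl)
      · exact Relation.EqvGen.rel _ _ (Or.inr rfl)
      · exact Relation.EqvGen.rel _ _ (Or.inr rfl)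
  · apply le_antisymm
    · refine Setoid.eqvGen_le ?_
      rintro y z (rfl | rfl)
      · exact (le_sup_left.trans le_sup_left : R ≤ _) (Relation.EqvGen.rel _ _ (Or.inl rfl))
      · by_cases hy : y ∈ e
        · have k1 : (R ⊔ Setoid.pair x (H.f x) ⊔ Setoid.pair (H.v x) (H.v (H.f x))) x (H.f x) :=
            (le_sup_left : _ ≤ _ ⊔ Setoid.pair (H.v x) (H.v (H.f x))) (Setoid.sup_pair_rel _ _ _)
          have k2 := Setoid.sup_pair_rel (R ⊔ Setoid.pair x (H.f x)) (H.v x) (H.v (H.f x))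
          rcases hfe.1 hy with rfl | rfl | rfl | rfl
          · exact k1
          · rw [← H.v_f]; exact k2
          · rw [H.f_f]; exact Setoid.symm' _ k1
          · rw [← H.v_f, H.f_f]; exact Setoid.symm' _ k2
        · rw [← hoff y hy, ← hwout hy]
          exact (le_sup_left.trans le_sup_left : R ≤ _) (Relation.EqvGen.rel _ _ (Or.inr rfl))
    · refine sup_le (sup_le (Setoid.eqvGen_le ?_) (Setoid.pair_le.2 ?_)) (Setoid.pair_le.2 ?_)
      · rintro y z (rfl | rfl)
        · exact Relation.EqvGen.rel _ _ (Or.inl rfl)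
        · by_cases hy : y ∈ e
          · rw [hwin hy]
          · rw [hwout hy, hoff y hy]; exact Relation.EqvGen.rel _ _ (Or.inr rfl)
      · exact Relation.EqvGen.rel _ _ (Or.inr rfl)
      · rw [H.v_f]; exact Relation.EqvGen.rel _ _ (Or.inr rfl)
  -- The arcs pair off the four corner points. The other end of the arc at x is v x for a non-loop,
  -- f x for an annulus and v (f x) for a Möbius band; the remaining pair is then forced.
  · have P : ∀ y ∈ e, ∃ q, q ≠ y ∧ q ∈ e ∧ R y q ∧ ∀ r ∈ e, R y r → r = y ∨ r = q := by
      intro y hy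
      obtain ⟨q, k1, k2, k3, k4⟩ := exists_partner H.c_c hww H.c_ne (hwin hy)
      exact ⟨q, k1, hfix.1 k2, k3, fun r hr => k4 r (hfix.2 hr)⟩
    have m1 : H.v x ∈ e := v_mem heE hx
    have m2 : H.f x ∈ e := f_mem heE hx
    have m3 : H.v (H.f x) ∈ e := v_mem heE m2
    obtain ⟨q, k1, k2, k3, k4⟩ := P x hx
    rcases hfe.1 k2 with rfl | rfl | rfl | rfl
    · exact absurd rfl k1
    · left
      have n1 : ¬ R x (H.f x) := fun h => by
        rcases k4 _ m2 h with h | h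
        · exact h2 h.symm
        · exact hvf h.symm
      refine ⟨k3, ?_, n1⟩
      obtain ⟨q, l1, l2, l3, l4⟩ := P _ m2
      rcases hfe.1 l2 with rfl | rfl | rfl | rfl
      · exact absurd (Setoid.symm' _ l3) n1
      · exact absurd (Setoid.trans' _ k3 (Setoid.symm' _ l3)) n1
      · exact absurd rfl l1
      · exact l3
    · right; left
      have n1 : ¬ R x (H.v x) := fun h => by
        rcases k4 _ m1 h with h | h
        · exact h1 h.symm
        · exact hvf h
      refine ⟨k3, ?_, n1⟩
      obtain ⟨q, l1, l2, l3, l4⟩ := P _ m1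
      rcases hfe.1 l2 with rfl | rfl | rfl | rfl
      · exact absurd (Setoid.symm' _ l3) n1
      · exact absurd rfl l1
      · exact absurd (Setoid.trans' _ k3 (Setoid.symm' _ l3)) n1
      · exact l3
    · right; right
      have n1 : ¬ R x (H.v x) := fun h => by
        rcases k4 _ m1 h with h | h
        · exact h1 h.symm
        · exact h4 h
      have n2 : ¬ R x (H.f x) := fun h => by
        rcases k4 _ m2 h with h | h
        · exact h2 h.symm
        · exact h5 h
      refine ⟨k3, ?_, n1, n2⟩
      obtain ⟨q, l1, l2, l3, l4⟩ := P _ m1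
      rcases hfe.1 l2 with rfl | rfl | rfl | rfl
      · exact absurd (Setoid.symm' _ l3) n1
      · exact absurd rfl l1
      · exact l3
      · exact absurd (Setoid.trans' _ k3 (Setoid.symm' _ l3)) n1

end RibbonGraph

namespace Setoid

variable {X : Type u}

/-- The setoid generated by the pairs `(x, g x)` with `x` in `S`. -/
def graphOn (g : X → X) (S : Set X) : Setoid X :=
  Relation.EqvGen.setoid fun x y => x ∈ S ∧ y = g x

theorem graphOn_le {g : X → X} {S : Set X} {s : Setoid X} :
    graphOn g S ≤ s ↔ ∀ x ∈ S, s x (g x) := by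
  constructor
  · intro h x hx
    exact h (Relation.EqvGen.rel _ _ ⟨hx, rfl⟩)
  · intro h
    refine Setoid.eqvGen_le ?_
    rintro x y ⟨hx, rfl⟩
    exact h x hx

theorem graphOn_rel {g : X → X} {S : Set X} {x : X} (hx : x ∈ S) : graphOn g S x (g x) :=
  graphOn_le.1 le_rfl x hx

theorem graphOn_congr {g g' : X → X} {S : Set X} (h : ∀ x ∈ S, g x = g' x) :
    graphOn g S = graphOn g' S := by
  apply le_antisymm <;> rw [graphOn_le] <;> intro x hx
  · rw [h x hx]; exact graphOn_rel hx
  · rw [← h x hx]; exact graphOn_rel hx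

theorem graphOn_union (g : X → X) (S T : Set X) :
    graphOn g (S ∪ T) = graphOn g S ⊔ graphOn g T := by
  apply le_antisymm
  · rw [graphOn_le]
    rintro x (hx | hx)
    · exact (le_sup_left : _ ≤ graphOn g S ⊔ graphOn g T) (graphOn_rel hx)
    · exact (le_sup_right : _ ≤ graphOn g S ⊔ graphOn g T) (graphOn_rel hx)
  · refine sup_le ?_ ?_ <;> rw [graphOn_le] <;> intro x hx
    · exact graphOn_rel (Or.inl hx)
    · exact graphOn_rel (Or.inr hx)

theorem graphOn_empty (g : X → X) : graphOn g ∅ = ⊥ :=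
  le_bot_iff.1 (graphOn_le.2 fun _ h => h.elim)

end Setoid

/-! ### Deletion, contraction and duality. -/

namespace RibbonGraph

variable {X : Type u} (G : RibbonGraph X)

theorem ext_of_maps {G H : RibbonGraph X} (hc : ∀ x, G.c x = H.c x) (hv : ∀ x, G.v x = H.v x)
    (hf : ∀ x, G.f x = H.f x) : G = H := by
  cases G; cases H
  obtain rfl := funext hc
  obtain rfl := funext hv
  obtain rfl := funext hf
  rfl

variable {G}

theorem eq_of_mem_edges {e e' : Set X} (he : e ∈ G.edges) (he' : e' ∈ G.edges) {x : X} (hx : x ∈ e)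
    (hx' : x ∈ e') : e = e' :=
  (edge_eq_of_mem he hx).2.trans (edge_eq_of_mem he' hx').2.symm

theorem nonempty_of_mem_edges {e : Set X} (he : e ∈ G.edges) : e.Nonempty := by
  obtain ⟨x, -, rfl⟩ := he
  exact ⟨x, by simp⟩

theorem mem_pts {A : Set (Set X)} {x : X} : x ∈ G.pts A ↔ ∃ e ∈ A, e ∈ G.edges ∧ x ∈ e := by
  simp [pts, and_assoc]

theorem mem_pts_iff_of_mem {A : Set (Set X)} {e : Set X} (he : e ∈ G.edges) {x : X} (hx : x ∈ e) :
    x ∈ G.pts A ↔ e ∈ A := by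
  rw [mem_pts]
  constructor
  · rintro ⟨e', h1, h2, h3⟩
    rwa [eq_of_mem_edges he h2 hx h3]
  · intro h
    exact ⟨e, h, he, hx⟩

theorem v_eq_f_of_notMem_pts_edges {x : X} (h : x ∉ G.pts G.edges) : G.v x = G.f x :=
  v_eq_f_of_forall_notMem fun e he hx => h (mem_pts.2 ⟨e, he, he, hx⟩)

theorem notMem_pts_of_disjoint {A B : Set (Set X)} (h : Disjoint A B) {x : X} (hx : x ∈ G.pts A) :
    x ∉ G.pts B := by
  obtain ⟨e, he, heG, hxe⟩ := mem_pts.1 hx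
  rw [mem_pts_iff_of_mem heG hxe]
  exact Set.disjoint_left.1 h he

theorem pts_union (A B : Set (Set X)) : G.pts (A ∪ B) = G.pts A ∪ G.pts B := by
  ext x; simp only [mem_pts, Set.mem_union]; aesop

theorem pts_empty : G.pts ∅ = ∅ := by
  ext x; simp [mem_pts]

theorem pts_singleton {e : Set X} (he : e ∈ G.edges) : G.pts {e} = e := by
  ext x
  simp [mem_pts, he]

variable (G)

theorem edges_dual : G.dual.edges = G.edges := by
  have key : ∀ H : RibbonGraph X, H.dual.edges ⊆ H.edges := by
    rintro H e ⟨x, hx, rfl⟩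
    refine ⟨x, hx.symm, ?_⟩
    change {x, H.f x, H.v x, H.f (H.v x)} = _
    ext z
    simp only [Set.mem_insert_iff, Set.mem_singleton_iff, H.v_f]
    tauto
  exact (key G).antisymm (key G.dual)

theorem pts_dual (A : Set (Set X)) : G.dual.pts A = G.pts A := by
  rw [pts, pts, edges_dual]

variable {G}

theorem delete_f_of_mem {A : Set (Set X)} {x : X} (h : x ∈ G.pts A) : (G.delete A).f x = G.v x :=
  if_pos h

theorem delete_f_of_notMem {A : Set (Set X)} {x : X} (h : x ∉ G.pts A) :
    (G.delete A).f x = G.f x :=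
  if_neg h

theorem contract_v_of_mem {A : Set (Set X)} {x : X} (h : x ∈ G.pts A) :
    (G.contract A).v x = G.f x :=
  if_pos h

theorem contract_v_of_notMem {A : Set (Set X)} {x : X} (h : x ∉ G.pts A) :
    (G.contract A).v x = G.v x :=
  if_neg h

variable (G)

theorem edges_delete (A : Set (Set X)) : (G.delete A).edges = G.edges \ A := by
  ext e
  constructor
  · rintro ⟨x, hx, rfl⟩
    have hA : x ∉ G.pts A := fun h => hx (delete_f_of_mem h).symm
    rw [delete_f_of_notMem hA] at hx ⊢
    have he : ({x, G.v x, G.f x, G.v (G.f x)} : Set X) ∈ G.edges := ⟨x, hx, rfl⟩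
    exact ⟨he, fun h => hA ((mem_pts_iff_of_mem he (by simp)).2 h)⟩
  · rintro ⟨he, hA⟩
    obtain ⟨x, hx⟩ := nonempty_of_mem_edges he
    have hxA : x ∉ G.pts A := mt (mem_pts_iff_of_mem he hx).1 hA
    obtain ⟨h1, h2⟩ := edge_eq_of_mem he hx
    refine ⟨x, ?_, ?_⟩
    · rw [delete_f_of_notMem hxA]; exact h1
    · rw [delete_f_of_notMem hxA]; exact h2

/-- Duality exchanges slots and free sides, so facts about contraction can be read off from facts
about deletion. -/
theorem contract_eq_dual (A : Set (Set X)) : G.contract A = (G.dual.delete A).dual := by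
  refine ext_of_maps (fun _ => rfl) (fun x => ?_) (fun _ => rfl)
  by_cases h : x ∈ G.pts A
  · rw [contract_v_of_mem h]
    exact (delete_f_of_mem (G := G.dual) (by rwa [pts_dual])).symm
  · rw [contract_v_of_notMem h]
    exact (delete_f_of_notMem (G := G.dual) (by rwa [pts_dual])).symm

theorem edges_contract (A : Set (Set X)) : (G.contract A).edges = G.edges \ A := by
  rw [contract_eq_dual, edges_dual, edges_delete, edges_dual]

theorem pts_delete (A B : Set (Set X)) : (G.delete A).pts B = G.pts (B \ A) := by
  rw [pts, pts, edges_delete]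
  congr 1
  ext e
  simp only [Set.mem_inter_iff, Set.mem_sdiff]
  tauto

theorem pts_contract (A B : Set (Set X)) : (G.contract A).pts B = G.pts (B \ A) := by
  rw [contract_eq_dual, pts_dual, pts_delete, pts_dual]

/-- The vertices of `G / A` are the boundary components of the spanning ribbon subgraph with edge
set `A`. -/
theorem vertexRel_contract (A : Set (Set X)) :
    (G.contract A).vertexRel = (G.delete (G.edges \ A)).boundaryRel := by
  -- Both sides are f on the edges in A and v on the other edges; away from the edges v and f agree.
  have h : ∀ x, (G.contract A).v x = (G.delete (G.edges \ A)).f x := by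
    intro x
    by_cases hx : x ∈ G.pts G.edges
    · obtain ⟨e, he, -, hxe⟩ := mem_pts.1 hx
      by_cases hA : e ∈ A
      · rw [contract_v_of_mem ((mem_pts_iff_of_mem he hxe).2 hA), delete_f_of_notMem]
        rw [mem_pts_iff_of_mem he hxe]
        exact fun h => h.2 hA
      · rw [contract_v_of_notMem (mt (mem_pts_iff_of_mem he hxe).1 hA), delete_f_of_mem]
        rw [mem_pts_iff_of_mem he hxe]
        exact ⟨he, hA⟩
    · have hn : ∀ B, x ∉ G.pts B := by
        intro B hB
        obtain ⟨e, -, he, hxe⟩ := mem_pts.1 hB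
        exact hx (mem_pts.2 ⟨e, he, he, hxe⟩)
      rw [contract_v_of_notMem (hn _), delete_f_of_notMem (hn _), v_eq_f_of_notMem_pts_edges hx]
  unfold vertexRel boundaryRel
  congr 1
  ext x y
  rw [h]; rfl

end RibbonGraph

namespace ColouredRibbonGraph

open RibbonGraph

variable {X : Type u} (G : ColouredRibbonGraph X)

theorem ext_of_eq {G H : ColouredRibbonGraph X} (h : G.toRibbonGraph = H.toRibbonGraph)
    (hv : G.vcol = H.vcol) (hb : G.bcol = H.bcol) : G = H := by
  cases G; cases H
  cases h; cases hv; cases hb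
  rfl

theorem vcol_v (x : X) : G.vcol x (G.v x) :=
  G.vertexRel_le (Relation.EqvGen.rel _ _ (Or.inr rfl))

theorem delete_bcol (A : Set (Set X)) :
    (G.delete A).bcol = G.bcol ⊔ Setoid.graphOn G.v (G.pts A) := rfl

theorem contract_vcol (A : Set (Set X)) :
    (G.contract A).vcol = G.vcol ⊔ Setoid.graphOn G.f (G.pts A) := rfl

theorem contract_eq_dual (A : Set (Set X)) : G.contract A = (G.dual.delete A).dual := by
  refine ext_of_eq (G.toRibbonGraph.contract_eq_dual A) ?_ rfl
  change G.vcol ⊔ Setoid.graphOn G.f (G.pts A) = G.vcol ⊔ Setoid.graphOn G.f (G.dual.pts A)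
  congr 2
  exact (G.toRibbonGraph.pts_dual A).symm

theorem edges_delete (A : Set (Set X)) : (G.delete A).edges = G.edges \ A :=
  G.toRibbonGraph.edges_delete A

theorem edges_contract (A : Set (Set X)) : (G.contract A).edges = G.edges \ A :=
  G.toRibbonGraph.edges_contract A

theorem delete_delete (A B : Set (Set X)) : (G.delete A).delete B = G.delete (A ∪ B) := by
  have hp : (G.delete A).pts B = G.pts (B \ A) := G.toRibbonGraph.pts_delete A B
  have hu : G.pts (A ∪ B) = G.pts A ∪ G.pts (B \ A) := by
    rw [← pts_union, Set.union_sdiff_self]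
  refine ext_of_eq (ext_of_maps (fun _ => rfl) (fun _ => rfl) fun x => ?_) rfl ?_
  · change ((G.toRibbonGraph.delete A).delete B).f x = (G.toRibbonGraph.delete (A ∪ B)).f x
    by_cases h1 : x ∈ G.pts (B \ A)
    · rw [delete_f_of_mem (G := G.toRibbonGraph.delete A) (by rwa [pts_delete]),
        delete_f_of_mem (hu ▸ Or.inr h1)]
      rfl
    · rw [delete_f_of_notMem (G := G.toRibbonGraph.delete A) (by rwa [pts_delete])]
      by_cases h2 : x ∈ G.pts A
      · rw [delete_f_of_mem h2, delete_f_of_mem (hu ▸ Or.inl h2)]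
      · rw [delete_f_of_notMem h2, delete_f_of_notMem]
        rw [hu]
        exact fun h => h.elim h2 h1
  · change (G.bcol ⊔ Setoid.graphOn G.v (G.pts A)) ⊔ Setoid.graphOn G.v ((G.delete A).pts B) =
      G.bcol ⊔ Setoid.graphOn G.v (G.pts (A ∪ B))
    rw [hp, hu, Setoid.graphOn_union, sup_assoc]

theorem contract_contract (A B : Set (Set X)) : (G.contract A).contract B = G.contract (A ∪ B) := by
  rw [contract_eq_dual, contract_eq_dual G, contract_eq_dual G, ← delete_delete]
  rfl

theorem delete_empty : G.delete ∅ = G := by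
  refine ext_of_eq (ext_of_maps (fun _ => rfl) (fun _ => rfl) fun x => ?_) rfl ?_
  · exact delete_f_of_notMem (by simp [pts_empty])
  · rw [delete_bcol, pts_empty, Setoid.graphOn_empty, sup_bot_eq]

theorem contract_empty : G.contract ∅ = G := by
  rw [contract_eq_dual, delete_empty]
  rfl

/-- Each operation changes the maps only at the corner points of its own edges, and disjoint edge
sets have disjoint corner points. The colour merges of either operation are therefore the same
before and after the other. -/
theorem delete_contract_of_disjoint {A B : Set (Set X)} (h : Disjoint A B) :
    (G.delete A).contract B = (G.contract B).delete A := by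
  have hB : (G.toRibbonGraph.delete A).pts B = G.pts B := by
    rw [pts_delete, h.symm.sdiff_eq_left]
  have hA : (G.toRibbonGraph.contract B).pts A = G.pts A := by
    rw [pts_contract, h.sdiff_eq_left]
  have h1 : ∀ x ∈ G.pts B, x ∉ G.pts A := fun x => notMem_pts_of_disjoint h.symm
  have h2 : ∀ x ∈ G.pts A, x ∉ G.pts B := fun x => notMem_pts_of_disjoint h
  have hf : ∀ x ∈ G.pts B, (G.delete A).f x = G.f x := fun x hx => delete_f_of_notMem (h1 x hx)
  have hv : ∀ x ∈ G.pts A, (G.contract B).v x = G.v x := fun x hx => contract_v_of_notMem (h2 x hx)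
  refine ext_of_eq (ext_of_maps (fun _ => rfl) (fun x => ?_) fun x => ?_) ?_ ?_
  · change ((G.toRibbonGraph.delete A).contract B).v x = (G.toRibbonGraph.contract B).v x
    by_cases hx : x ∈ G.pts B
    · rw [contract_v_of_mem (hB ▸ hx), contract_v_of_mem hx]
      exact hf x hx
    · rw [contract_v_of_notMem (hB ▸ hx), contract_v_of_notMem hx]
      rfl
  · change (G.toRibbonGraph.delete A).f x = ((G.toRibbonGraph.contract B).delete A).f x
    by_cases hx : x ∈ G.pts A
    · rw [delete_f_of_mem hx, delete_f_of_mem (hA ▸ hx)]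
      exact (hv x hx).symm
    · rw [delete_f_of_notMem hx, delete_f_of_notMem (hA ▸ hx)]
      rfl
  · change G.vcol ⊔ Setoid.graphOn (G.delete A).f ((G.toRibbonGraph.delete A).pts B) =
      G.vcol ⊔ Setoid.graphOn G.f (G.pts B)
    rw [hB, Setoid.graphOn_congr hf]
  · change G.bcol ⊔ Setoid.graphOn G.v (G.pts A) =
      G.bcol ⊔ Setoid.graphOn (G.contract B).v ((G.toRibbonGraph.contract B).pts A)
    rw [hA, Setoid.graphOn_congr hv]

/-! ### States and their behaviour under deletion and contraction. -/

/-- The edgeless coloured ribbon graph obtained by contracting the edges in `A` and deleting the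
others. -/
def state (A : Set (Set X)) : ColouredRibbonGraph X := (G.contract A).delete (G.edges \ A)

theorem state_delete_singleton {e : Set X} (he : e ∈ G.edges) {A : Set (Set X)} (hA : e ∉ A) :
    (G.delete {e}).state A = G.state A := by
  rw [state, state, delete_contract_of_disjoint _ (Set.disjoint_singleton_left.2 hA),
    delete_delete, edges_delete]
  congr 1
  ext a
  simp only [Set.mem_union, Set.mem_sdiff, Set.mem_singleton_iff]
  by_cases h : a = e
  · subst h; simp [he, hA]
  · simp [h]

theorem state_contract_singleton (e : Set X) (A : Set (Set X)) :
    (G.contract {e}).state A = G.state (insert e A) := by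
  rw [state, state, contract_contract, edges_contract, Set.singleton_union, sdiff_sdiff]
  rfl

/-- This lemma and the next three identify the two states of each one-edge graph that defines the
type of e with states of G: those of E \ e and E for G / eᶜ, those of ∅ and {e} for G \ eᶜ. -/
theorem state_contract_sdiff_empty {e : Set X} (he : e ∈ G.edges) :
    (G.contract (G.edges \ {e})).delete {e} = G.state (G.edges \ {e}) := by
  rw [state, Set.sdiff_sdiff_cancel_left (Set.singleton_subset_iff.2 he)]

theorem state_contract_sdiff_singleton {e : Set X} (he : e ∈ G.edges) :
    (G.contract (G.edges \ {e})).contract {e} = G.state G.edges := by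
  rw [state, Set.sdiff_self, delete_empty, contract_contract,
    Set.sdiff_union_of_subset (Set.singleton_subset_iff.2 he)]

theorem state_delete_sdiff_empty {e : Set X} (he : e ∈ G.edges) :
    (G.delete (G.edges \ {e})).delete {e} = G.state ∅ := by
  rw [state, contract_empty, delete_delete, Set.sdiff_empty,
    Set.sdiff_union_of_subset (Set.singleton_subset_iff.2 he)]

theorem state_delete_sdiff_singleton (e : Set X) :
    (G.delete (G.edges \ {e})).contract {e} = G.state {e} := by
  rw [state, delete_contract_of_disjoint _ Set.disjoint_sdiff_left]

/-- The number of vertex colour classes. -/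
def numV : ℤ := Nat.card (Quotient G.vcol)

/-- The number of boundary colour classes. -/
def numB : ℤ := Nat.card (Quotient G.bcol)

end ColouredRibbonGraph

/-! ### The exponent vector of a one-edge graph. -/

/-- The exponents of `a_bs`, `a_bp^{1/2}`, `a_olc`, `a_olh^{1/2}` in `a_k`. -/
def EdgeKind.exps : EdgeKind → ℤ × ℤ × ℤ × ℤ
  | .bs => (1, 0, 0, 0)
  | .bp => (0, 2, 0, 0)
  | .olc => (0, 0, 1, 0)
  | .olh => (0, 0, 0, 2)
  | .nl => (0, 1, 0, 1)

namespace ColouredRibbonGraph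

open RibbonGraph

variable {X : Type u} {H : ColouredRibbonGraph X} {e : Set X}

/-- The ends of a slot lie on one vertex and so have one colour; hence the identifications at the
four corner points of e amount to a single one. -/
theorem graphOn_edge_f {x : X} (he : e ∈ H.edges) (hx : x ∈ e) :
    H.vcol ⊔ Setoid.graphOn H.f (H.pts {e}) = H.vcol ⊔ Setoid.pair x (H.f x) := by
  rw [pts_singleton he]
  apply le_antisymm
  · refine sup_le le_sup_left (Setoid.graphOn_le.2 fun y hy => ?_)
    have k1 := Setoid.sup_pair_rel H.vcol x (H.f x)
    have k2 : ∀ z, (H.vcol ⊔ Setoid.pair x (H.f x)) z (H.v z) := fun z =>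
      (le_sup_left : H.vcol ≤ _) (H.vcol_v z)
    have k3 : (H.vcol ⊔ Setoid.pair x (H.f x)) (H.v x) (H.f (H.v x)) := by
      rw [← H.v_f]
      exact Setoid.trans' _ (Setoid.symm' _ (k2 x)) (Setoid.trans' _ k1 (k2 _))
    rw [(edge_eq_of_mem he hx).2] at hy
    rcases hy with rfl | rfl | rfl | rfl
    · exact k1
    · exact k3
    · rw [H.f_f]; exact Setoid.symm' _ k1
    · rw [H.v_f, H.f_f]; exact Setoid.symm' _ k3
  · exact sup_le le_sup_left (Setoid.pair_le.2
      ((le_sup_right : _ ≤ H.vcol ⊔ _) (Setoid.graphOn_rel hx)))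

theorem graphOn_edge_v {x : X} (he : e ∈ H.edges) (hx : x ∈ e) :
    H.bcol ⊔ Setoid.graphOn H.v (H.pts {e}) = H.bcol ⊔ Setoid.pair x (H.v x) := by
  have h := graphOn_edge_f (H := H.dual) (x := x) (e := e) (by
    change e ∈ H.toRibbonGraph.dual.edges
    rwa [edges_dual]) hx
  change H.bcol ⊔ Setoid.graphOn H.v (H.toRibbonGraph.dual.pts {e}) = _ at h
  rw [pts_dual] at h
  exact h

/-- How the numbers of colour classes and vertices of the two states of a coloured ribbon graph
with one edge depend on its kind. -/
theorem exps_of_isKind (he : H.edges = {e}) {k : EdgeKind} (hk : H.IsKind e k) :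
    k.exps =
      ((H.delete {e}).numV - (H.contract {e}).numV,
        1 + (H.delete {e}).numVertices - (H.contract {e}).numVertices
          - 2 * ((H.delete {e}).numV - (H.contract {e}).numV),
        (H.contract {e}).numB - (H.delete {e}).numB,
        2 - 2 * ((H.contract {e}).numB - (H.delete {e}).numB)
          - (1 + (H.delete {e}).numVertices - (H.contract {e}).numVertices)) := by
  have := H.finite
  have heE : e ∈ H.edges := he ▸ rfl
  have hV : (H.delete {e}).numVertices = H.numVertices := rfl
  have hB : (H.contract {e}).numVertices = H.numBoundary := by
    change Nat.card (Quotient (H.toRibbonGraph.contract {e}).vertexRel) = _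
    rw [H.toRibbonGraph.vertexRel_contract, he, Set.sdiff_self]
    exact congrArg (fun K => RibbonGraph.numBoundary (toRibbonGraph K)) H.delete_empty
  have hn : (H.delete {e}).numV = Nat.card (Quotient H.vcol) := rfl
  have hm : (H.contract {e}).numB = Nat.card (Quotient H.bcol) := rfl
  have key : ∀ x ∈ e,
      (H.vcol x (H.f x) → (H.contract {e}).numV = Nat.card (Quotient H.vcol)) ∧
      (¬ H.vcol x (H.f x) → (H.contract {e}).numV + 1 = Nat.card (Quotient H.vcol)) ∧
      (H.bcol x (H.v x) → (H.delete {e}).numB = Nat.card (Quotient H.bcol)) ∧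
      (¬ H.bcol x (H.v x) → (H.delete {e}).numB + 1 = Nat.card (Quotient H.bcol)) := by
    intro x hx
    rw [numV, numB, contract_vcol, delete_bcol, graphOn_edge_f heE hx, graphOn_edge_v heE hx]
    refine ⟨fun h => ?_, fun h => ?_, fun h => ?_, fun h => ?_⟩
    · rw [Setoid.sup_pair_of_rel h]
    · exact_mod_cast Setoid.card_sup_pair h
    · rw [Setoid.sup_pair_of_rel h]
    · exact_mod_cast Setoid.card_sup_pair h
  rw [hV, hB, hn, hm]
  -- The topological kind gives the change in the number of vertices. A non-loop has one boundary
  -- component on both sides, and a loop has one end vertex, so at most one of the two colour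
  -- conditions is not forced; for nl both are.
  cases k <;> obtain ⟨x, hx, h⟩ := hk <;> obtain ⟨k1, k2, k3, k4⟩ := key x hx <;>
    have hs := numBoundary_of_edges_eq_singleton he hx <;>
    have hv := @H.vertexRel_le x (H.f x) <;> have hb := @H.boundaryRel_le x (H.v x) <;>
    simp only [EdgeKind.exps, Prod.mk.injEq]
  · obtain ⟨h1, h2⟩ := h
    rcases hs with ⟨-, h3, h4⟩ | ⟨h3, -⟩ | ⟨h3, -⟩
    rotate_left
    · exact absurd h3 h1
    · exact absurd h3 h1
    have := k2 h2
    have := k3 (hb h3)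
    omega
  · obtain ⟨h1, h2⟩ := h
    rcases hs with ⟨-, h3, h4⟩ | ⟨h3, -⟩ | ⟨h3, -⟩
    rotate_left
    · exact absurd h3 h1
    · exact absurd h3 h1
    have := k1 h2
    have := k3 (hb h3)
    omega
  · obtain ⟨h1, h2, h3⟩ := h
    rcases hs with ⟨h4, -⟩ | ⟨-, -, h4⟩ | ⟨-, h4, -⟩
    · exact absurd h1 h4
    rotate_left
    · exact absurd h4 h2
    have := k1 (hv h1)
    have := k4 h3
    omega
  · obtain ⟨h1, h2, h3⟩ := h
    rcases hs with ⟨h4, -⟩ | ⟨-, -, h4⟩ | ⟨-, h4, -⟩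
    · exact absurd h1 h4
    rotate_left
    · exact absurd h4 h2
    have := k1 (hv h1)
    have := k3 h3
    omega
  · obtain ⟨h1, h2⟩ := h
    rcases hs with ⟨h4, -⟩ | ⟨-, h4, -⟩ | ⟨-, -, h4⟩
    · exact absurd h1 h4
    · exact absurd h2 h4
    have := k1 (hv h1)
    have := k3 (hb h2)
    omega

end ColouredRibbonGraph

/-! ### Ranks of the quotient graphs -/

namespace ColouredRibbonGraph

open RibbonGraph

variable {X : Type u} (G : ColouredRibbonGraph X)

/-- Contraction merges vertex colour classes exactly along the edges of 𝔾/𝒱 in A, so components are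
colour classes after contraction. -/
theorem numComponents_quotGraph_restrict (A : Set (Set X)) :
    (G.quotGraph.restrict A).numComponents = Nat.card (Quotient (G.contract A).vcol) := by
  have hle : G.vcol ≤ (G.contract A).vcol := le_sup_left
  let F : Quot (fun x y : (G.quotGraph.restrict A).vertexSet => (G.quotGraph.restrict A).Adj x y) →
      Quotient (G.contract A).vcol :=
    Quot.lift (fun q => Setoid.map_of_le hle q.1) (by
      rintro ⟨p, -⟩ ⟨q, -⟩ ⟨e, heA, he, x, hx, rfl, rfl⟩
      refine Quotient.sound (s := (G.contract A).vcol) ?_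
      exact (le_sup_right : _ ≤ G.vcol ⊔ _)
        (Setoid.graphOn_rel (g := G.f) ((mem_pts_iff_of_mem he hx).2 heA)))
  let g : X → Quot (fun x y : (G.quotGraph.restrict A).vertexSet =>
      (G.quotGraph.restrict A).Adj x y) :=
    fun x => Quot.mk _ ⟨Quotient.mk G.vcol x, Set.mem_univ _⟩
  have hg : (G.contract A).vcol ≤ Setoid.ker g := by
    rw [contract_vcol]
    refine sup_le (fun x y hxy => ?_) (Setoid.graphOn_le.2 fun x hx => ?_)
    · rw [Setoid.ker_def]
      simp only [g]
      congr 2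
      exact Quotient.sound hxy
    · rw [Setoid.ker_def]
      obtain ⟨e, heA, he, hxe⟩ := mem_pts.1 hx
      exact Quot.sound ⟨e, heA, he, x, hxe, rfl, rfl⟩
  refine Nat.card_congr ⟨F, Quotient.lift g fun _ _ h => hg h, ?_, ?_⟩
  · rintro ⟨⟨⟨x⟩, -⟩⟩
    rfl
  · rintro ⟨x⟩
    rfl

theorem state_vcol (A : Set (Set X)) : (G.state A).vcol = (G.contract A).vcol := rfl

/-- The two operations commute here, and contraction leaves the boundary colours unchanged. -/
theorem state_bcol (A : Set (Set X)) : (G.state A).bcol = (G.delete (G.edges \ A)).bcol := by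
  rw [state, ← delete_contract_of_disjoint _ Set.disjoint_sdiff_left]
  rfl

theorem rank_quotGraph (A : Set (Set X)) :
    G.quotGraph.rank A = (G.state ∅).numV - (G.state A).numV := by
  rw [Graph.rank, numComponents_quotGraph_restrict, numV, numV, state_vcol, state_vcol,
    contract_empty]
  congr 2
  exact Nat.card_congr (Equiv.Set.univ _)

theorem dual_contract_vcol (A : Set (Set X)) : (G.dual.contract A).vcol = (G.delete A).bcol := by
  rw [contract_eq_dual]
  rfl

theorem rank_dualQuotGraph (A : Set (Set X)) :
    G.dualQuotGraph.rank A =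
      Nat.card (Quotient G.bcol) - (Nat.card (Quotient (G.delete A).bcol) : ℤ) := by
  rw [show G.dualQuotGraph.rank A = G.dual.quotGraph.rank A from rfl, Graph.rank,
    numComponents_quotGraph_restrict, dual_contract_vcol]
  congr 2
  exact Nat.card_congr (Equiv.Set.univ _)

theorem kV_eq : (G.kV : ℤ) = (G.state G.edges).numV := by
  rw [kV, ← Graph.restrict_self G.quotGraph, numComponents_quotGraph_restrict]
  rfl

theorem kB_eq : (G.kB : ℤ) = (G.state ∅).numB := by
  rw [kB, show G.dualQuotGraph.numComponents = G.dual.quotGraph.numComponents from rfl, ← Graph.restrict_self G.dual.quotGraph, numComponents_quotGraph_restrict,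
    dual_contract_vcol, numB,
    state_bcol, Set.sdiff_empty]
  change (Nat.card (Quotient (G.delete G.toRibbonGraph.dual.edges).bcol) : ℤ) = _
  rw [edges_dual]

theorem numVertices_state (A : Set (Set X)) :
    (G.state A).numVertices = (G.toRibbonGraph.delete (G.edges \ A)).numBoundary := by
  rw [numBoundary, ← vertexRel_contract]
  rfl

theorem numVertices_state_empty : (G.state ∅).numVertices = G.numVertices := by
  rw [state, contract_empty]
  rfl

/-- The integers `r₁(A)`, `2 r₂(A)`, `r₃(A)` and `2 r₄(A)`. -/
def exps (A : Finset (Set X)) : ℤ × ℤ × ℤ × ℤ :=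
  ((G.state ∅).numV - (G.state A).numV,
    A.card + (G.state ∅).numVertices - (G.state A).numVertices
      - 2 * ((G.state ∅).numV - (G.state A).numV),
    (G.state A).numB - (G.state ∅).numB,
    2 * A.card - 2 * ((G.state A).numB - (G.state ∅).numB)
      - (A.card + (G.state ∅).numVertices - (G.state A).numVertices))

theorem r₁_eq (A : Finset (Set X)) : G.r₁ A = (G.exps A).1 := G.rank_quotGraph A

theorem two_mul_r₂ (A : Finset (Set X)) : 2 * G.r₂ A = (G.exps A).2.1 := by
  simp only [r₂, rho, exps]
  rw [rank_quotGraph, ← numVertices_state, numVertices_state_empty]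
  push_cast
  ring

theorem r₃_eq (A : Finset (Set X)) : G.r₃ A = (G.exps A).2.2.1 := by
  simp only [r₃, exps]
  rw [rank_dualQuotGraph, rank_dualQuotGraph, numB, numB, state_bcol, state_bcol, Set.sdiff_empty]
  ring

theorem two_mul_r₄ (A : Finset (Set X)) : 2 * G.r₄ A = (G.exps A).2.2.2 := by
  have h : (G.r₄ A) = A.card - G.r₃ A - G.rho A := by
    simp only [r₄, r₃]
    push_cast
    ring
  rw [h, r₃_eq]
  simp only [rho, exps]
  rw [← numVertices_state, numVertices_state_empty]
  push_cast
  ring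

theorem exps_empty : G.exps ∅ = 0 := by
  simp [exps]

theorem exps_delete {e : Set X} (he : e ∈ G.edges) {A : Finset (Set X)} (hA : e ∉ A) :
    (G.delete {e}).exps A = G.exps A := by
  have hA' : e ∉ (A : Set (Set X)) := by simp [hA]
  simp only [exps, state_delete_singleton G he hA',
    state_delete_singleton G he (Set.notMem_empty e)]

-- The increment from ∅ to A ∪ {e} splits at {e}. The part from ∅ to {e} is computed in G \ eᶜ and
-- gives j; the rest belongs to G / e, whose state of ∅ is the state of {e} in G.
open Classical in
theorem exps_insert {e : Set X} (he : e ∈ G.edges) {i j : EdgeKind} (h : G.IsType e i j)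
    {A : Finset (Set X)} (hA : e ∉ A) :
    G.exps (insert e A) = j.exps + (G.contract {e}).exps A := by
  have h1 : (G.delete (G.edges \ {e})).edges = {e} := by
    rw [edges_delete, Set.sdiff_sdiff_cancel_left (Set.singleton_subset_iff.2 he)]
  rw [exps_of_isKind h1 h.2, state_delete_sdiff_empty G he, state_delete_sdiff_singleton]
  simp only [exps, state_contract_singleton, Finset.coe_insert, Finset.card_insert_of_notMem hA,
    insert_empty_eq, Prod.mk_add_mk, Prod.mk.injEq]
  push_cast
  refine ⟨?_, ?_, ?_, ?_⟩ <;> ring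

theorem coe_edgeFinset : (G.edgeFinset : Set (Set X)) = G.edges := by
  simp [edgeFinset]

theorem mem_edgeFinset {e : Set X} : e ∈ G.edgeFinset ↔ e ∈ G.edges := by
  rw [← coe_edgeFinset, Finset.mem_coe]

open Classical in
theorem edgeFinset_delete (e : Set X) : (G.delete {e}).edgeFinset = G.edgeFinset.erase e := by
  rw [← Finset.coe_inj, Finset.coe_erase, coe_edgeFinset, coe_edgeFinset, edges_delete]

open Classical in
theorem edgeFinset_contract (e : Set X) :
    (G.contract {e}).edgeFinset = G.edgeFinset.erase e := by
  rw [← Finset.coe_inj, Finset.coe_erase, coe_edgeFinset, coe_edgeFinset, edges_contract]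

-- The last increment, from E \ e to E, is computed in G / eᶜ and gives i.
open Classical in
theorem exps_edgeFinset {e : Set X} (he : e ∈ G.edges) {i j : EdgeKind} (h : G.IsType e i j) :
    G.exps G.edgeFinset = i.exps + G.exps (G.edgeFinset.erase e) := by
  have h1 : (G.contract (G.edges \ {e})).edges = {e} := by
    rw [edges_contract, Set.sdiff_sdiff_cancel_left (Set.singleton_subset_iff.2 he)]
  rw [exps_of_isKind h1 h.1, state_contract_sdiff_empty G he, state_contract_sdiff_singleton G he]
  have hc : ((G.edgeFinset.erase e).card : ℤ) = G.edgeFinset.card - 1 := by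
    have := Finset.card_erase_add_one (G.mem_edgeFinset.2 he)
    omega
  simp only [exps, Finset.coe_erase, coe_edgeFinset, hc, Prod.mk_add_mk, Prod.mk.injEq]
  refine ⟨?_, ?_, ?_, ?_⟩ <;> ring

end ColouredRibbonGraph

/-! ### The state sum -/

theorem sqrtVar_ne_zero (p : Param) : sqrtVar p ≠ 0 := by
  rw [sqrtVar, Ne, FaithfulSMul.algebraMap_eq_zero_iff]
  exact MvPolynomial.X_ne_zero p

theorem var_ne_zero (p : Param) : var p ≠ 0 := pow_ne_zero 2 (sqrtVar_ne_zero p)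

/-- The product of powers of `a_bs`, `a_bp^{1/2}`, `a_olc`, `a_olh^{1/2}` with given exponents. -/
def aMono (t : ℤ × ℤ × ℤ × ℤ) : ParamField :=
  var .aBs ^ t.1 * sqrtVar .aBp ^ t.2.1 * var .aOlc ^ t.2.2.1 * sqrtVar .aOlh ^ t.2.2.2

/-- The product of powers of `b_bs`, `b_bp^{1/2}`, `b_olc`, `b_olh^{1/2}` with given exponents. -/
def bMono (t : ℤ × ℤ × ℤ × ℤ) : ParamField :=
  var .bBs ^ t.1 * sqrtVar .bBp ^ t.2.1 * var .bOlc ^ t.2.2.1 * sqrtVar .bOlh ^ t.2.2.2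

theorem aMono_zero : aMono 0 = 1 := by simp [aMono]

theorem bMono_zero : bMono 0 = 1 := by simp [bMono]

theorem aMono_add (s t : ℤ × ℤ × ℤ × ℤ) : aMono (s + t) = aMono s * aMono t := by
  simp only [aMono, Prod.fst_add, Prod.snd_add, zpow_add₀ (var_ne_zero _),
    zpow_add₀ (sqrtVar_ne_zero _)]
  ring

theorem bMono_add (s t : ℤ × ℤ × ℤ × ℤ) : bMono (s + t) = bMono s * bMono t := by
  simp only [bMono, Prod.fst_add, Prod.snd_add, zpow_add₀ (var_ne_zero _),
    zpow_add₀ (sqrtVar_ne_zero _)]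
  ring

/-- This is where the value of a_nl matters: the exponent vector of nl is half the sum of those of
bp and olh. -/
theorem aMono_exps (k : EdgeKind) : aMono k.exps = aCoeff k := by
  cases k <;> simp [aMono, aCoeff, EdgeKind.exps] <;> rfl

theorem bMono_exps (k : EdgeKind) : bMono k.exps = bCoeff k := by
  cases k <;> simp [bMono, bCoeff, EdgeKind.exps] <;> rfl

namespace ColouredRibbonGraph

open RibbonGraph

variable {X : Type u} (G : ColouredRibbonGraph X)

/-- The value of `U` at an edgeless coloured ribbon graph. -/
def leafValue : ParamField :=
  var .α ^ Nat.card (Quotient G.vcol) * var .β ^ Nat.card (Quotient G.bcol)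
    * var .γ ^ G.numVertices

/-- The contribution of the state `A` to the state sum. -/
def stateTerm (A : Finset (Set X)) : ParamField :=
  (G.state A).leafValue * aMono (G.exps G.edgeFinset - G.exps A) * bMono (G.exps A)

/-- The state sum. -/
def stateSum : ParamField := ∑ A ∈ G.edgeFinset.powerset, G.stateTerm A

theorem stateSum_of_edges_eq_empty (h : G.edges = ∅) : G.stateSum = G.leafValue := by
  have hE : G.edgeFinset = ∅ := by
    rw [← Finset.coe_inj, coe_edgeFinset, h, Finset.coe_empty]
  rw [stateSum, hE, Finset.powerset_empty, Finset.sum_singleton, stateTerm, hE, sub_self,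
    exps_empty, aMono_zero, bMono_zero, mul_one, mul_one, Finset.coe_empty, state, h,
    Set.sdiff_empty, contract_empty, delete_empty]

theorem stateSum_step {e : Set X} (he : e ∈ G.edges) {i j : EdgeKind} (h : G.IsType e i j) :
    G.stateSum = aCoeff i * (G.delete {e}).stateSum + bCoeff j * (G.contract {e}).stateSum := by
  classical
  have hE : G.edgeFinset = insert e (G.edgeFinset.erase e) :=
    (Finset.insert_erase (G.mem_edgeFinset.2 he)).symm
  have hne : e ∉ G.edgeFinset.erase e := Finset.notMem_erase e _
  -- The sets A without e are the states of G \ e, where only the exponents of E change, by those of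
  -- i. The sets with e are the states of G / e.
  rw [stateSum, hE, Finset.sum_powerset_insert hne, stateSum, stateSum, edgeFinset_delete,
    edgeFinset_contract, Finset.mul_sum, Finset.mul_sum]
  congr 1
  · refine Finset.sum_congr rfl fun A hA => ?_
    have hA' : e ∉ A := fun h => hne (Finset.mem_powerset.1 hA h)
    rw [stateTerm, stateTerm, edgeFinset_delete, exps_delete G he hA', exps_delete G he hne,
      state_delete_singleton G he (by simpa using hA'), exps_edgeFinset G he h, add_sub_assoc,
      aMono_add, aMono_exps]
    ring
  · refine Finset.sum_congr rfl fun A hA => ?_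
    have hA' : e ∉ A := fun h => hne (Finset.mem_powerset.1 hA h)
    -- Now e is counted as the first edge inserted instead of the last. The exponents of E and of A
    -- then shift by the same j, so the a-monomial is unchanged and the b-monomial gains the factor
    -- b_j.
    have h1 : G.exps G.edgeFinset = j.exps + (G.contract {e}).exps (G.edgeFinset.erase e) := by
      conv_lhs => rw [hE]
      exact exps_insert G he h hne
    rw [stateTerm, stateTerm, edgeFinset_contract, h1, exps_insert G he h hA',
      state_contract_singleton, Finset.coe_insert, add_sub_add_left_eq_sub, bMono_add, bMono_exps]
    ring

end ColouredRibbonGraph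

/-- Here γ, a₂, a₄, b₂, b₄ stand for square roots, and the eᵢ and yᵢ for `exps` at E and at A. The
relation `hb` expresses the number b of vertices of the state through the exponents; |A| cancels
between y₂ and y₄. -/
theorem zpow_stateTerm_identity {F : Type*} [Field F] {α β γ a₁ a₂ a₃ a₄ b₁ b₂ b₃ b₄ : F}
    (hα : α ≠ 0) (hβ : β ≠ 0) (hγ : γ ≠ 0) (ha₁ : a₁ ≠ 0) (ha₂ : a₂ ≠ 0) (ha₃ : a₃ ≠ 0)
    (ha₄ : a₄ ≠ 0) {k l v n m b e₁ e₂ e₃ e₄ y₁ y₂ y₃ y₄ : ℤ} (hn : n = k + e₁ - y₁)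
    (hm : m = l + y₃) (hb : 2 * b = 2 * v - 2 * y₁ - y₂ + 2 * y₃ + y₄) :
    α ^ k * β ^ l * (γ ^ 2) ^ v * (α * a₁) ^ e₁ * a₂ ^ e₂ * a₃ ^ e₃ * a₄ ^ e₄
        * ((b₁ / (α * γ ^ 2 * a₁)) ^ y₁ * (b₂ / (γ * a₂)) ^ y₂ * (β * γ ^ 2 * b₃ / a₃) ^ y₃
          * (γ * b₄ / a₄) ^ y₄) =
      α ^ n * β ^ m * (γ ^ 2) ^ b
        * (a₁ ^ (e₁ - y₁) * a₂ ^ (e₂ - y₂) * a₃ ^ (e₃ - y₃) * a₄ ^ (e₄ - y₄))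
        * (b₁ ^ y₁ * b₂ ^ y₂ * b₃ ^ y₃ * b₄ ^ y₄) := by
  have h2 : ∀ z : ℤ, (γ ^ 2) ^ z = γ ^ (2 * z) := fun z => by
    rw [zpow_mul, zpow_ofNat]
  have hb' : γ ^ (2 * b) = γ ^ (2 * v) / γ ^ (2 * y₁) / γ ^ y₂ * γ ^ (2 * y₃) * γ ^ y₄ := by
    rw [hb, zpow_add₀ hγ, zpow_add₀ hγ, zpow_sub₀ hγ, zpow_sub₀ hγ]
  subst hn hm
  simp only [div_zpow, mul_zpow, h2, hb', zpow_add₀ hα, zpow_add₀ hβ, zpow_sub₀ hα,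
    zpow_sub₀ ha₁, zpow_sub₀ ha₂, zpow_sub₀ ha₃, zpow_sub₀ ha₄]
  ring

namespace ColouredRibbonGraph

variable {X : Type u} (G : ColouredRibbonGraph X)

theorem halfPow_eq {q : ℚ} {n : ℤ} (h : 2 * q = n) (s : ParamField) : halfPow s q = s ^ n := by
  rw [halfPow, h, Int.floor_intCast]

theorem stateSum_eq : G.stateSum =
    var .α ^ G.kV * var .β ^ G.kB * var .γ ^ G.numVertices
      * (var .α * var .aBs) ^ G.r₁ G.edgeFinset
      * halfPow (sqrtVar .aBp) (G.r₂ G.edgeFinset)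
      * var .aOlc ^ G.r₃ G.edgeFinset
      * halfPow (sqrtVar .aOlh) (G.r₄ G.edgeFinset)
      * ∑ A ∈ G.edgeFinset.powerset,
          (var .bBs / (var .α * var .γ * var .aBs)) ^ G.r₁ A
            * halfPow (sqrtVar .bBp / (sqrtVar .γ * sqrtVar .aBp)) (G.r₂ A)
            * (var .β * var .γ * var .bOlc / var .aOlc) ^ G.r₃ A
            * halfPow (sqrtVar .γ * sqrtVar .bOlh / sqrtVar .aOlh) (G.r₄ A) := by
  rw [stateSum, Finset.mul_sum]
  refine Finset.sum_congr rfl fun A _ => ?_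
  simp only [halfPow_eq (G.two_mul_r₂ _), halfPow_eq (G.two_mul_r₄ _), r₁_eq, r₃_eq]
  rw [← zpow_natCast (var .α) G.kV, ← zpow_natCast (var .β) G.kB,
    ← zpow_natCast (var .γ) G.numVertices, kV_eq, kB_eq]
  have hE := G.coe_edgeFinset
  rw [show var .γ = sqrtVar .γ ^ 2 from rfl,
    zpow_stateTerm_identity (var_ne_zero _) (var_ne_zero _) (sqrtVar_ne_zero _) (var_ne_zero _)
      (sqrtVar_ne_zero _) (var_ne_zero _) (sqrtVar_ne_zero _) (n := (G.state A).numV)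
      (m := (G.state A).numB) (b := (G.state A).numVertices)]
  · simp only [stateTerm, leafValue, aMono, bMono, numV, numB, zpow_natCast, Prod.fst_sub,
      Prod.snd_sub]
    rfl
  · simp only [exps, hE]
    ring
  · simp only [exps]
    ring
  · simp only [exps, numVertices_state_empty]
    ring

end ColouredRibbonGraph

/-! ### Existence, integrality and uniqueness. -/

namespace ColouredRibbonGraph

open RibbonGraph

variable {X Y : Type u}

theorem exists_isKind (H : ColouredRibbonGraph X) {e : Set X} (he : e.Nonempty) :
    ∃ k, H.IsKind e k := by
  obtain ⟨x, hx⟩ := he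
  by_cases h1 : H.vertexRel x (H.f x)
  · by_cases h2 : H.boundaryRel x (H.v x)
    · exact ⟨.nl, x, hx, h1, h2⟩
    · by_cases h3 : H.bcol x (H.v x)
      · exact ⟨.olh, x, hx, h1, h2, h3⟩
      · exact ⟨.olc, x, hx, h1, h2, h3⟩
  · by_cases h2 : H.vcol x (H.f x)
    · exact ⟨.bp, x, hx, h1, h2⟩
    · exact ⟨.bs, x, hx, h1, h2⟩

theorem exists_isType (G : ColouredRibbonGraph X) {e : Set X} (he : e ∈ G.edges) :
    ∃ i j, G.IsType e i j := by
  obtain ⟨i, hi⟩ := (G.contract (G.edges \ {e})).exists_isKind (nonempty_of_mem_edges he)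
  obtain ⟨j, hj⟩ := (G.delete (G.edges \ {e})).exists_isKind (nonempty_of_mem_edges he)
  exact ⟨i, j, hi, hj⟩

theorem deletion_contraction_induction {P : ColouredRibbonGraph X → Prop}
    (edgeless : ∀ G : ColouredRibbonGraph X, G.edges = ∅ → P G)
    (step : ∀ G : ColouredRibbonGraph X, ∀ e ∈ G.edges, P (G.delete {e}) → P (G.contract {e}) → P G)
    (G : ColouredRibbonGraph X) : P G := by
  classical
  induction hn : G.edgeFinset.card generalizing G with
  | zero =>
    refine edgeless G ?_
    rw [← coe_edgeFinset, Finset.card_eq_zero.1 hn, Finset.coe_empty]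
  | succ n ih =>
    obtain ⟨e, he⟩ := Finset.card_pos.1 (by omega : 0 < G.edgeFinset.card)
    have hc : (G.edgeFinset.erase e).card = n := by
      rw [Finset.card_erase_of_mem he, hn, Nat.add_sub_cancel]
    exact step G e (G.mem_edgeFinset.1 he) (ih _ (by rw [edgeFinset_delete, hc]))
      (ih _ (by rw [edgeFinset_contract, hc]))

/-- The terms are written with integer powers and divisions, so membership is not read off from
them; the recursion uses only sums and products of generators. -/
theorem stateSum_mem_coeffRing (G : ColouredRibbonGraph X) : G.stateSum ∈ coeffRing := by
  have hgen : ∀ z ∈ ({var .α, var .β, var .γ, var .aBs, sqrtVar .aBp, var .aOlc, sqrtVar .aOlh,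
      var .bBs, sqrtVar .bBp, var .bOlc, sqrtVar .bOlh} : Set ParamField), z ∈ coeffRing :=
    fun z hz => Subring.subset_closure hz
  simp only [Set.mem_insert_iff, Set.mem_singleton_iff, forall_eq_or_imp, forall_eq] at hgen
  obtain ⟨hα, hβ, hγ, ha₁, ha₂, ha₃, ha₄, hb₁, hb₂, hb₃, hb₄⟩ := hgen
  induction G using deletion_contraction_induction with
  | edgeless G h =>
    rw [stateSum_of_edges_eq_empty G h, leafValue]
    exact mul_mem (mul_mem (pow_mem hα _) (pow_mem hβ _)) (pow_mem hγ _)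
  | step G e he h1 h2 =>
    obtain ⟨i, j, h⟩ := G.exists_isType he
    rw [stateSum_step G he h]
    refine add_mem (mul_mem ?_ h1) (mul_mem ?_ h2)
    · cases i
      · exact ha₁
      · exact pow_mem ha₂ 2
      · exact ha₃
      · exact pow_mem ha₄ 2
      · exact mul_mem ha₂ ha₄
    · cases j
      · exact hb₁
      · exact pow_mem hb₂ 2
      · exact hb₃
      · exact pow_mem hb₄ 2
      · exact mul_mem hb₂ hb₄

end ColouredRibbonGraph

open ColouredRibbonGraph in
theorem isDeletionContraction_stateSum :
    IsDeletionContraction fun (X : Type u) (G : ColouredRibbonGraph X) =>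
      (⟨G.stateSum, G.stateSum_mem_coeffRing⟩ : coeffRing) where
  step _ G _ he _ _ h := G.stateSum_step he h
  edgeless _ G h := G.stateSum_of_edges_eq_empty h

theorem IsDeletionContraction.eq_stateSum {U : ∀ X : Type u, ColouredRibbonGraph X → coeffRing}
    (hU : IsDeletionContraction U) {X : Type u} (G : ColouredRibbonGraph X) :
    (U X G : ParamField) = G.stateSum := by
  induction G using ColouredRibbonGraph.deletion_contraction_induction with
  | edgeless G h => rw [hU.edgeless X G h, G.stateSum_of_edges_eq_empty h]; rfl
  | step G e he h1 h2 =>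
    obtain ⟨i, j, h⟩ := G.exists_isType he
    rw [hU.step X G e he i j h, G.stateSum_step he h, h1, h2]

/-! ### Invariance under inserting and forgetting empty slots. -/

namespace ColouredRibbonGraph.IsErasure

open RibbonGraph

variable {X Y : Type u} {G : ColouredRibbonGraph X} {H : ColouredRibbonGraph Y} {φ : Y → X}

theorem dual (h : G.IsErasure H φ) : G.dual.IsErasure H.dual φ where
  injective := h.injective
  map_v := h.map_f
  map_f := h.map_v
  map_c y := by
    refine (h.map_c y).imp_right fun ⟨h1, h2⟩ => ⟨h1, ?_⟩
    change G.c (G.f (G.c (φ y))) = φ (H.c y)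
    rw [(h.unattached _ h1).1, h2]
  unattached x hx := ⟨(h.unattached x hx).1.symm, (h.unattached x hx).2⟩
  vcol_iff := h.bcol_iff
  bcol_iff := h.vcol_iff

/-- A forgotten point is moved along its corner to the surviving other end, which lies on the same
vertex and the same boundary component. This retraction inverts φ on classes. -/
theorem exists_retraction (h : G.IsErasure H φ) :
    ∃ ψ : X → Y, (∀ y, ψ (φ y) = y) ∧ ∀ x, x ∉ Set.range φ → φ (ψ x) = G.c x := by
  have : ∀ x, ∃ y, (∀ z, φ z = x → z = y) ∧ (x ∉ Set.range φ → φ y = G.c x) := by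
    intro x
    by_cases hx : x ∈ Set.range φ
    · obtain ⟨y, rfl⟩ := hx
      exact ⟨y, fun z hz => h.injective hz, fun hn => (hn ⟨y, rfl⟩).elim⟩
    · obtain ⟨y, hy⟩ := (h.unattached x hx).2
      exact ⟨y, fun z hz => (hx ⟨z, hz⟩).elim, fun _ => hy⟩
  choose ψ h1 h2 using this
  exact ⟨ψ, fun y => (h1 _ y rfl).symm, h2⟩

theorem rel_retraction {ψ : X → Y} (h1 : ∀ y, ψ (φ y) = y)
    (h2 : ∀ x, x ∉ Set.range φ → φ (ψ x) = G.c x) {s : Setoid X} (hs : G.vertexRel ≤ s ∨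
      G.boundaryRel ≤ s) (x : X) : s x (φ (ψ x)) := by
  by_cases hx : x ∈ Set.range φ
  · obtain ⟨y, rfl⟩ := hx
    rw [h1]
  · rw [h2 x hx]
    rcases hs with hs | hs
    · exact hs (Relation.EqvGen.rel _ _ (Or.inl rfl))
    · exact hs (Relation.EqvGen.rel _ _ (Or.inl rfl))

theorem vertexRel_iff (h : G.IsErasure H φ) (y z : Y) :
    H.vertexRel y z ↔ G.vertexRel (φ y) (φ z) := by
  constructor
  · have hle : H.vertexRel ≤ Setoid.comap φ G.vertexRel := by
      refine Setoid.eqvGen_le ?_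
      rintro y z (rfl | rfl)
      · rw [Setoid.comap_rel]
        rcases h.map_c y with h1 | ⟨-, h2⟩
        · rw [← h1]
          exact Relation.EqvGen.rel _ _ (Or.inl rfl)
        · rw [← h2]
          refine Setoid.trans' _ (Relation.EqvGen.rel _ _ (Or.inl rfl)) ?_
          exact Setoid.trans' _ (Relation.EqvGen.rel _ _ (Or.inr rfl))
            (Relation.EqvGen.rel _ _ (Or.inl rfl))
      · rw [Setoid.comap_rel, ← h.map_v]
        exact Relation.EqvGen.rel _ _ (Or.inr rfl)
    exact fun hyz => hle hyz
  · obtain ⟨ψ, h1, h2⟩ := h.exists_retraction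
    have hle : G.vertexRel ≤ Setoid.comap ψ H.vertexRel := by
      refine Setoid.eqvGen_le ?_
      rintro x x' (rfl | rfl) <;> rw [Setoid.comap_rel] <;> by_cases hx : x ∈ Set.range φ
      · obtain ⟨y, rfl⟩ := hx
        rcases h.map_c y with h3 | ⟨h3, -⟩
        · rw [h3, h1, h1]
          exact Relation.EqvGen.rel _ _ (Or.inl rfl)
        · have h4 : ψ (G.c (φ y)) = y := h.injective (by rw [h2 _ h3, G.c_c])
          rw [h4, h1]
      · rw [← h2 x hx, h1]
      · obtain ⟨y, rfl⟩ := hx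
        rw [h.map_v, h1, h1]
        exact Relation.EqvGen.rel _ _ (Or.inr rfl)
      -- Both ends of the slot at x are forgotten; they retract to the two ends of the fused corner,
      -- which are joined by `H.c`.
      · have hvx : G.v x ∉ Set.range φ := by
          rintro ⟨z, hz⟩
          exact hx ⟨H.v z, by rw [← h.map_v, hz, G.v_v]⟩
        have hc : G.c (φ (ψ x)) = x := by rw [h2 x hx, G.c_c]
        rcases h.map_c (ψ x) with h3 | ⟨-, h3⟩
        · exact (hx ⟨_, h3.symm.trans hc⟩).elim
        · rw [hc, ← h2 _ hvx] at h3
          rw [h.injective h3]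
          exact Relation.EqvGen.rel _ _ (Or.inl rfl)
    intro hyz
    have := hle hyz
    rwa [Setoid.comap_rel, h1, h1] at this

theorem boundaryRel_iff (h : G.IsErasure H φ) (y z : Y) :
    H.boundaryRel y z ↔ G.boundaryRel (φ y) (φ z) :=
  h.dual.vertexRel_iff y z

theorem isKind (h : G.IsErasure H φ) {e : Set Y} {k : EdgeKind} (hk : H.IsKind e k) :
    G.IsKind (φ '' e) k := by
  cases k <;> obtain ⟨y, hy, hk⟩ := hk <;> refine ⟨φ y, Set.mem_image_of_mem φ hy, ?_⟩ <;>
    simpa only [h.map_v, h.map_f, ← h.vertexRel_iff, ← h.boundaryRel_iff, ← h.vcol_iff,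
      ← h.bcol_iff] using hk

theorem edges_eq (h : G.IsErasure H φ) : G.edges = (φ '' ·) '' H.edges := by
  ext e
  constructor
  · rintro ⟨x, hx, rfl⟩
    have hxr : x ∈ Set.range φ := by
      by_contra hn
      exact hx (h.unattached x hn).1.symm
    obtain ⟨y, rfl⟩ := hxr
    refine ⟨_, ⟨y, fun hy => hx (by rw [h.map_v, h.map_f, hy]), rfl⟩, ?_⟩
    simp only [Set.image_insert_eq, Set.image_singleton, h.map_v, h.map_f]
  · rintro ⟨_, ⟨y, hy, rfl⟩, rfl⟩
    refine ⟨φ y, fun hx => hy (h.injective (by rw [← h.map_v, hx, h.map_f])), ?_⟩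
    simp only [Set.image_insert_eq, Set.image_singleton, h.map_v, h.map_f]

theorem pts_image (h : G.IsErasure H φ) (A : Set (Set Y)) :
    G.pts ((φ '' ·) '' A) = φ '' H.pts A := by
  rw [pts, pts, h.edges_eq, ← Set.image_inter h.injective.image_injective, Set.sUnion_image,
    Set.sUnion_eq_biUnion, Set.image_iUnion₂]

/-- The colour merges in a deletion happen at corner points of edges, none of which is forgotten, so
φ and its retraction both respect the merged colourings. -/
theorem sup_graphOn_iff (h : G.IsErasure H φ) {s : Setoid X} {t : Setoid Y}
    (hs : G.vertexRel ≤ s ∨ G.boundaryRel ≤ s) (hst : ∀ y z, t y z ↔ s (φ y) (φ z))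
    {g : X → X} {g' : Y → Y} (hg : ∀ y, g (φ y) = φ (g' y)) (P : Set Y) (y z : Y) :
    (t ⊔ Setoid.graphOn g' P) y z ↔ (s ⊔ Setoid.graphOn g (φ '' P)) (φ y) (φ z) := by
  constructor
  · have hle : t ⊔ Setoid.graphOn g' P ≤ Setoid.comap φ (s ⊔ Setoid.graphOn g (φ '' P)) := by
      refine sup_le (fun a b hab => ?_) (Setoid.graphOn_le.2 fun a ha => ?_)
      · exact (le_sup_left : s ≤ _) ((hst a b).1 hab)
      · rw [Setoid.comap_rel, ← hg]
        exact (le_sup_right : _ ≤ s ⊔ _) (Setoid.graphOn_rel (Set.mem_image_of_mem φ ha))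
    exact fun hyz => hle hyz
  · obtain ⟨ψ, h1, h2⟩ := h.exists_retraction
    have hle : s ⊔ Setoid.graphOn g (φ '' P) ≤ Setoid.comap ψ (t ⊔ Setoid.graphOn g' P) := by
      refine sup_le (fun a b hab => ?_) (Setoid.graphOn_le.2 ?_)
      · refine (le_sup_left : t ≤ _) ((hst _ _).2 ?_)
        exact Setoid.trans' _ (Setoid.symm' _ (rel_retraction h1 h2 hs a))
          (Setoid.trans' _ hab (rel_retraction h1 h2 hs b))
      · rintro _ ⟨a, ha, rfl⟩
        rw [Setoid.comap_rel, hg, h1, h1]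
        exact (le_sup_right : _ ≤ t ⊔ _) (Setoid.graphOn_rel ha)
    intro hyz
    have := hle hyz
    rwa [Setoid.comap_rel, h1, h1] at this

theorem delete (h : G.IsErasure H φ) (A : Set (Set Y)) :
    (G.delete ((φ '' ·) '' A)).IsErasure (H.delete A) φ where
  injective := h.injective
  map_v := h.map_v
  map_f y := by
    change (G.toRibbonGraph.delete _).f (φ y) = φ ((H.toRibbonGraph.delete A).f y)
    by_cases hy : y ∈ H.pts A
    · rw [delete_f_of_mem hy, delete_f_of_mem (h.pts_image A ▸ Set.mem_image_of_mem φ hy), h.map_v]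
    · rw [delete_f_of_notMem hy, delete_f_of_notMem, h.map_f]
      rwa [h.pts_image, h.injective.mem_set_image]
  map_c := h.map_c
  unattached x hx := by
    refine ⟨?_, (h.unattached x hx).2⟩
    change (G.toRibbonGraph.delete _).f x = G.v x
    rw [delete_f_of_notMem, (h.unattached x hx).1]
    rw [h.pts_image]
    exact fun hn => hx (Set.image_subset_range _ _ hn)
  vcol_iff := h.vcol_iff
  bcol_iff y z := by
    rw [delete_bcol, delete_bcol, h.pts_image]
    exact h.sup_graphOn_iff (Or.inr G.boundaryRel_le) h.bcol_iff h.map_v _ y z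

theorem contract (h : G.IsErasure H φ) (A : Set (Set Y)) :
    (G.contract ((φ '' ·) '' A)).IsErasure (H.contract A) φ := by
  rw [contract_eq_dual, contract_eq_dual]
  exact (h.dual.delete A).dual

theorem isType (h : G.IsErasure H φ) {e : Set Y} {i j : EdgeKind} (hij : H.IsType e i j) :
    G.IsType (φ '' e) i j := by
  have hE : G.edges \ {φ '' e} = (φ '' ·) '' (H.edges \ {e}) := by
    rw [Set.image_sdiff h.injective.image_injective, Set.image_singleton, h.edges_eq]
  rw [IsType, hE]
  exact ⟨(h.contract _).isKind hij.1, (h.delete _).isKind hij.2⟩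

theorem card_quotient_eq (h : G.IsErasure H φ) {s : Setoid X} {t : Setoid Y}
    (hs : G.vertexRel ≤ s ∨ G.boundaryRel ≤ s) (hst : ∀ y z, t y z ↔ s (φ y) (φ z)) :
    Nat.card (Quotient s) = Nat.card (Quotient t) := by
  obtain ⟨ψ, h1, h2⟩ := h.exists_retraction
  symm
  refine Nat.card_congr (Equiv.ofBijective
    (Quotient.map φ fun y z hyz => (hst y z).1 hyz) ⟨?_, ?_⟩)
  · rintro ⟨y⟩ ⟨z⟩ hyz
    exact Quotient.sound ((hst y z).2 (Quotient.exact hyz))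
  · rintro ⟨x⟩
    exact ⟨Quotient.mk t (ψ x),
      Quotient.sound (Setoid.symm' _ (rel_retraction h1 h2 hs x))⟩

theorem leafValue_eq (h : G.IsErasure H φ) : G.leafValue = H.leafValue := by
  rw [leafValue, leafValue, numVertices, numVertices,
    h.card_quotient_eq (Or.inl G.vertexRel_le) h.vcol_iff,
    h.card_quotient_eq (Or.inr G.boundaryRel_le) h.bcol_iff,
    h.card_quotient_eq (Or.inl le_rfl) h.vertexRel_iff]

/-- An erasure matches edges and their types and restricts to erasures of the minors, so both sides
satisfy the same recursion. -/
theorem stateSum_eq (h : G.IsErasure H φ) : G.stateSum = H.stateSum := by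
  induction H using deletion_contraction_induction generalizing G with
  | edgeless H hH =>
    rw [stateSum_of_edges_eq_empty H hH, stateSum_of_edges_eq_empty G, h.leafValue_eq]
    rw [h.edges_eq, hH, Set.image_empty]
  | step H e he ih1 ih2 =>
    obtain ⟨i, j, hij⟩ := H.exists_isType he
    have he' : φ '' e ∈ G.edges := by
      rw [h.edges_eq]
      exact Set.mem_image_of_mem _ he
    have hd := h.delete {e}
    have hc := h.contract {e}
    rw [Set.image_singleton] at hd hc
    rw [H.stateSum_step he hij, G.stateSum_step he' (h.isType hij), ih1 hd, ih2 hc]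

end ColouredRibbonGraph.IsErasure

theorem ColouredRibbonGraph.Equivalent.stateSum_eq {X Y : Type u} {G : ColouredRibbonGraph X}
    {H : ColouredRibbonGraph Y} (h : G.Equivalent H) : G.stateSum = H.stateSum := by
  induction h with
  | erase _ _ _ h => exact h.stateSum_eq
  | symm _ _ _ ih => exact ih.symm
  | trans _ _ _ _ _ ih1 ih2 => exact ih1.trans ih2

end

/-- There is exactly one function `U` on coloured ribbon graphs that satisfies the
deletion-contraction recursion; it is invariant under equivalence, and it is given by the
state sum over all sets of edges. -/
theorem theorem3p5 :
    (∃! U : (∀ X : Type u, ColouredRibbonGraph X → coeffRing), IsDeletionContraction U) ∧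
    ∀ U : (∀ X : Type u, ColouredRibbonGraph X → coeffRing), IsDeletionContraction U →
      (∀ (X Y : Type u) (G : ColouredRibbonGraph X) (H : ColouredRibbonGraph Y),
        G.Equivalent H → U X G = U Y H) ∧
      ∀ (X : Type u) (G : ColouredRibbonGraph X),
        (U X G : ParamField) =
          var .α ^ G.kV * var .β ^ G.kB * var .γ ^ G.numVertices
            * (var .α * var .aBs) ^ G.r₁ G.edgeFinset
            * halfPow (sqrtVar .aBp) (G.r₂ G.edgeFinset)
            * var .aOlc ^ G.r₃ G.edgeFinset
            * halfPow (sqrtVar .aOlh) (G.r₄ G.edgeFinset)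
            * ∑ A ∈ G.edgeFinset.powerset,
                (var .bBs / (var .α * var .γ * var .aBs)) ^ G.r₁ A
                  * halfPow (sqrtVar .bBp / (sqrtVar .γ * sqrtVar .aBp)) (G.r₂ A)
                  * (var .β * var .γ * var .bOlc / var .aOlc) ^ G.r₃ A
                  * halfPow (sqrtVar .γ * sqrtVar .bOlh / sqrtVar .aOlh) (G.r₄ A) := by
  refine ⟨⟨_, isDeletionContraction_stateSum, fun U hU => ?_⟩, fun U hU => ⟨?_, ?_⟩⟩
  · funext X G
    exact Subtype.ext (hU.eq_stateSum G)
  · intro X Y G H h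
    exact Subtype.ext ((hU.eq_stateSum G).trans (h.stateSum_eq.trans (hU.eq_stateSum H).symm))
  · intro X G
    exact (hU.eq_stateSum G).trans G.stateSum_eq
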